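/- Let $n\ge 0$ be an integer and let $M\subset\mathbb{R}^{n+1}$ be a smooth hypersurface, i.e. an embedded $n$-dimensional $C^\infty$ submanifold without boundary (not necessarily closed, connected or orientable). Let $\nu_M$ be its unit normal (defined up to sign), $dV$ the $n$-dimensional Hausdorff measure on $M$, and $C^1_c(M)$ the space of real $C^1$ functions on $M$ with compact support in $M$. For $\varphi\in C^1_c(M)$ the tangential gradient is $\nabla_T\varphi=\nabla\varphi-(\nabla\varphi\cdot\nu_M)\nu_M=(\delta_1\varphi,\dots,\delta_{n+1}\varphi)$, where $\varphi$ is extended near the given point of $M$ to a $C^1$ function on $\mathbb{R}^{n+1}$. The mean curvature is $H=\operatorname{div}_T\nu_M=\sum_{i=1}^{n+1}\delta_i\nu_M^i$ (the sum of the principal curvatures, computed with a local smooth choice of $\nu_M$), and the mean curvature vector is $\mathcal H=H\nu_M$, which does not depend on the sign of $\nu_M$. (1) Let $p\ge 1$ and $a\in[0,n)$. Then for every $\varphi\in C^1_c(M)$ all the integrals below are finite and $$(n-a)\int_M\frac{|\varphi|^p}{|x|^a}\,dV+a\int_M\Big(\frac{x}{|x|}\cdot\nu_M\Big)^2\frac{|\varphi|^p}{|x|^a}\,dV\le\Big(\int_M\frac{|\varphi|^p}{|x|^a}\,dV\Big)^{\frac{p-1}{p}}\Big(\int_M\frac{|p\nabla_T\varphi-\mathcal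 H\varphi|^p}{|x|^{a-p}}\,dV\Big)^{\frac1p}$$ (for $p=1$ the first factor on the right-hand side is $1$). (2) Consequently, if $M$ is minimal (that is, $H\equiv0$) and $p\in[1,n)$, then for every $\varphi\in C^1_c(M)$ $$\frac{(n-p)^p}{p^p}\int_M\frac{|\varphi|^p}{|x|^p}\,dV\le\int_M|\nabla_T\varphi|^p\,dV .$$ The constant is the best Euclidean one: if $p\in[1,n)$, $C\in\mathbb{R}$, and $C\int_M|\varphi|^p|x|^{-p}\,dV\le\int_M|\nabla_T\varphi|^p\,dV$ for all $\varphi\in C^1_c(M)$ in the case $M=\mathbb{R}^n\times\{0\}$, then $C\le (n-p)^p/p^p$. -/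

import Mathlib

open MeasureTheory Filter Topology
open scoped ContDiff Gradient

noncomputable section

namespace Hypersurface

/-- The Euclidean space `ℝ^{n+1}`. -/
abbrev Space (n : ℕ) : Type := EuclideanSpace ℝ (Fin (n + 1))

/-- `M` is a smooth (embedded, `n`-dimensional, without boundary) hypersurface of `ℝ^{n+1}`:
near each of its points it is the zero set of a smooth function with nowhere vanishing gradient.
It need be neither closed, nor connected, nor orientable. -/
def IsSmoothHypersurface {n : ℕ} (M : Set (Space n)) : Prop :=
  ∀ x ∈ M, ∃ U : Set (Space n), IsOpen U ∧ x ∈ U ∧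
    ∃ f : Space n → ℝ, ContDiffOn ℝ ∞ f U ∧ (∀ y ∈ U, ∇ f y ≠ 0) ∧ M ∩ U = {y ∈ U | f y = 0}

/-- `v` is a unit normal to `M` at `x`: a unit vector orthogonal to all tangent vectors
(for a hypersurface, `tangentConeAt ℝ M x` is the tangent space at `x`). -/
def IsUnitNormalAt {n : ℕ} (M : Set (Space n)) (x v : Space n) : Prop :=
  ‖v‖ = 1 ∧ ∀ w ∈ tangentConeAt ℝ M x, inner ℝ v w = 0

/-- `N` is (the extension to a neighbourhood of `x` in `ℝ^{n+1}` of) a smooth unit normal field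
along `M` near `x`. -/
def IsUnitNormalFieldNear {n : ℕ} (M : Set (Space n)) (x : Space n)
    (N : Space n → Space n) : Prop :=
  ContDiffAt ℝ ∞ N x ∧ ∀ᶠ y in 𝓝[M] x, IsUnitNormalAt M y (N y)

/-- A chosen smooth unit normal field along `M` near `x`. For a hypersurface and `x ∈ M` it exists,
and on `M` near `x` it is determined up to a constant sign. -/
def localNormal {n : ℕ} (M : Set (Space n)) (x : Space n) : Space n → Space n :=
  Classical.epsilon (IsUnitNormalFieldNear M x)

/-- The unit normal `ν_M` to `M` at `x`. No continuity in `x` of the choice of the sign is asked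
for (`M` may be non-orientable): everything below is unchanged if the sign is changed at some
points. -/
def unitNormal {n : ℕ} (M : Set (Space n)) (x : Space n) : Space n :=
  localNormal M x x

/-- For a function `ψ` on `ℝ^{n+1}`, the vector `∇ψ - (∇ψ · ν_M) ν_M` at `x`, whose components are
the tangential derivatives `δ_i ψ = ∂_i ψ - ν_M^i ∑_j (∂_j ψ) ν_M^j`. At a point of a hypersurface
it depends only on `ψ` restricted to `M` near that point. -/
def ambientTangentialGradient {n : ℕ} (M : Set (Space n)) (ψ : Space n → ℝ) (x : Space n) :
    Space n :=
  ∇ ψ x - (inner ℝ (∇ ψ x) (unitNormal M x)) • unitNormal M x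

/-- `ψ` is, near `x`, a `C¹` extension of `φ : M → ℝ` to `ℝ^{n+1}`. -/
def IsC1ExtensionNear {n : ℕ} (M : Set (Space n)) (φ : Space n → ℝ) (x : Space n)
    (ψ : Space n → ℝ) : Prop :=
  ContDiffAt ℝ 1 ψ x ∧ ∀ᶠ y in 𝓝[M] x, ψ y = φ y

/-- `φ ∈ C¹_c(M)`: a `C¹` function on `M` whose support is contained in a compact subset of `M`.
Only the values of `φ` on `M` matter. If `M` is compact, this is `C¹(M)`. -/
def IsC1c {n : ℕ} (M : Set (Space n)) (φ : Space n → ℝ) : Prop :=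
  (∀ x ∈ M, ∃ ψ, IsC1ExtensionNear M φ x ψ) ∧
    ∃ K ⊆ M, IsCompact K ∧ ∀ x ∈ M, x ∉ K → φ x = 0

/-- The tangential gradient `∇_T φ` at `x` of a `C¹` function `φ` on `M`, computed with a `C¹`
extension of `φ`. -/
def tangentialGradient {n : ℕ} (M : Set (Space n)) (φ : Space n → ℝ) (x : Space n) : Space n :=
  ambientTangentialGradient M (Classical.epsilon (IsC1ExtensionNear M φ x)) x

/-- The tangential divergence `div_T Z = ∑_i δ_i Z^i` at `x` of a vector field `Z` (defined near
`x` in `ℝ^{n+1}`, not necessarily tangent to `M`). -/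
def tangentialDivergence {n : ℕ} (M : Set (Space n)) (Z : Space n → Space n) (x : Space n) : ℝ :=
  ∑ i, ambientTangentialGradient M (fun y => Z y i) x i

/-- The mean curvature `H = div_T ν_M` (the sum of the principal curvatures) at `x`, with respect
to the unit normal `unitNormal M x`. -/
def meanCurvature {n : ℕ} (M : Set (Space n)) (x : Space n) : ℝ :=
  tangentialDivergence M (localNormal M x) x

/-- The mean curvature vector `𝓗 = H ν_M`; it does not depend on the sign of `ν_M`. -/
def meanCurvatureVector {n : ℕ} (M : Set (Space n)) (x : Space n) : Space n :=
  meanCurvature M x • unitNormal M x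

/-- `M` has zero mean curvature. -/
def IsMinimal {n : ℕ} (M : Set (Space n)) : Prop :=
  ∀ x ∈ M, meanCurvature M x = 0

/-- The volume measure `dV` of `M`: the `n`-dimensional Hausdorff measure restricted to `M`. -/
def vol {n : ℕ} (M : Set (Space n)) : Measure (Space n) :=
  (Measure.euclideanHausdorffMeasure n).restrict M

/-- The flat hypersurface `ℝ^n × {0}` of `ℝ^{n+1}`. -/
def flat (n : ℕ) : Set (Space n) := {x | x (Fin.last n) = 0}

end Hypersurface

end

/-! ### Hausdorff measure and the area formula for immersions -/

noncomputable section

namespace Hypersurface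

/-! Everything rests on the divergence theorem on `M`: the integral of `∇_T φ - φ 𝓗` over `M`
vanishes for `φ ∈ C¹_c(M)` (`integral_inner_defect`). A partition of unity reduces it to graphs of
`C²` functions `u` over `ℝ^n`. There the area formula (`hausdorff_restrict_graph`) turns `dV` into
`J dy` with `J = √(1 + |∇u|²)`, and `J b · (∇_T ψ - ψ 𝓗)` is, for every constant vector `b`, a sum
of partial derivatives of compactly supported `C¹` functions (`graphDiv_eq`), so its integral is
zero.

Applied to the coordinates of `h x`, and since `div_T x = n`, this gives `∫ (n h + ∇_T h · x - h 𝓗 ·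
x) = 0`. For `h = |φ|^p |x|^(-a)` the derivative of the weight contributes `-a |x|^(-a-2) (|x|² - (x
· ν)²) |φ|^p`, and the identity becomes: the left-hand side of (1) equals `-∫ |φ|^(p-2) φ (p ∇_T φ -
φ 𝓗) · x |x|^(-a)`. Cauchy–Schwarz at each point and Hölder's inequality bound this by the
right-hand side. As `h` need not be `C¹`, the identity is first proved with `|φ|^p` and `|x|^(-a)`
regularized by `δ > 0` (`integral_regIntegrand`). Dominated convergence then gives `δ → 0`, because
`|x|^(-a)` is locally integrable on `M` for `a < n` (`integrableOn_mul_rpow`).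

For (2), take `a = p` and `𝓗 = 0`, drop the nonnegative normal term and divide by a power of `∫
|φ|^p |x|^(-p)`. For optimality, test with `|x|^(-γ) h(log |x|)`, `γ = (n - p) / p`: the
substitution `r = e^t` leaves `C ∫ |h|^p ≤ ∫ |h' - γ h|^p` on the line. Stretching `h` makes `h'`
negligible, whence `C ≤ γ^p`. -/

theorem measure_le_of_locally_le {X : Type*} [TopologicalSpace X] [SecondCountableTopology X]
    [MeasurableSpace X] [BorelSpace X] {μ ν : Measure X}
    (h : ∀ x, ∃ U ∈ 𝓝 x, ∀ A ⊆ U, MeasurableSet A → μ A ≤ ν A) : μ ≤ ν := by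
  choose U hU hle using h
  obtain ⟨s, hs, hcov⟩ := TopologicalSpace.countable_cover_nhds
    (fun x => interior_mem_nhds.2 (hU x))
  have : s.Nonempty ∨ IsEmpty X := by
    rcases isEmpty_or_nonempty X with h | ⟨⟨x⟩⟩
    · exact Or.inr h
    · left
      have : x ∈ ⋃ x ∈ s, interior (U x) := by rw [hcov]; trivial
      simp only [Set.mem_iUnion] at this
      exact ⟨this.choose, this.choose_spec.choose⟩
  rcases this with hne | hem
  swap
  · intro A; rw [Set.eq_empty_of_isEmpty A]; simp
  obtain ⟨f, hf⟩ := hs.exists_eq_range hne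
  have hcov' : ⋃ k, interior (U (f k)) = Set.univ := by
    rw [← hcov, hf, Set.biUnion_range]
  refine Measure.le_iff.2 fun A hA => ?_
  -- Each disjoint piece lies in a single set of the cover, where the comparison is known, and both
  -- measures of `A` are the sums over the pieces.
  set D := disjointed fun k => interior (U (f k))
  have hD : ⋃ k, D k = Set.univ := by rw [iUnion_disjointed, hcov']
  have hDm : ∀ k, MeasurableSet (D k) :=
    fun k => MeasurableSet.disjointed (fun k => isOpen_interior.measurableSet) k
  have key : ∀ m : Measure X, m A = ∑' k, m (A ∩ D k) := by
    intro m
    rw [← measure_iUnion, ← Set.inter_iUnion, hD, Set.inter_univ]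
    · intro i j hij
      exact (disjoint_disjointed _ hij).mono Set.inter_subset_right Set.inter_subset_right
    · exact fun k => hA.inter (hDm k)
  rw [key μ, key ν]
  exact ENNReal.tsum_le_tsum fun k => hle (f k) _
    (Set.inter_subset_right.trans ((disjointed_subset _ k).trans interior_subset))
    (hA.inter (hDm k))

/-- The hypothesis makes `k` constant on the fibres of `h` in `A`, so that `k ∘ h⁻¹` is a
well-defined `C`-Lipschitz map on `h '' A`. Two maps out of `T` are compared so that an immersion
and its derivative can be exchanged in both directions. -/
theorem euclideanHausdorffMeasure_image_le_of_edist_le {T X Y : Type*}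
    [EMetricSpace X] [MeasurableSpace X] [BorelSpace X]
    [EMetricSpace Y] [MeasurableSpace Y] [BorelSpace Y] {h : T → X} {k : T → Y} {A : Set T}
    {C : NNReal} (d : ℕ)
    (hC : ∀ a ∈ A, ∀ b ∈ A, edist (k a) (k b) ≤ C * edist (h a) (h b)) :
    μHE[d] (k '' A) ≤ (C : ENNReal) ^ d * μHE[d] (h '' A) := by
  rcases A.eq_empty_or_nonempty with rfl | ⟨a₀, -⟩
  · simp
  have : Nonempty T := ⟨a₀⟩
  set i := Function.invFunOn h A
  have hi : ∀ a ∈ A, i (h a) ∈ A ∧ h (i (h a)) = h a := fun a ha =>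
    ⟨Function.invFunOn_mem ⟨a, ha, rfl⟩, Function.invFunOn_eq ⟨a, ha, rfl⟩⟩
  have hk : ∀ a ∈ A, k (i (h a)) = k a := by
    intro a ha
    have := hC _ (hi a ha).1 _ ha
    rw [(hi a ha).2, edist_self, mul_zero] at this
    exact edist_le_zero.1 this
  have hL : LipschitzOnWith C (k ∘ i) (h '' A) := by
    rintro _ ⟨a, ha, rfl⟩ _ ⟨b, hb, rfl⟩
    simp only [Function.comp_apply]
    rw [hk a ha, hk b hb]
    exact hC a ha b hb
  have himg : k '' A = (k ∘ i) '' (h '' A) := by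
    rw [Set.image_image]
    exact Set.image_congr fun a ha => (hk a ha).symm
  simp_rw [Measure.euclideanHausdorffMeasure_def, Measure.smul_apply]
  have := hL.hausdorffMeasure_image_le (d := d) (by positivity)
  rw [← himg, ENNReal.rpow_natCast] at this
  simp only [ENNReal.smul_def, smul_eq_mul]
  calc _ ≤ _ := mul_le_mul_right this _
    _ = _ := by ring

section AreaFormula

variable {U V : Type*} [NormedAddCommGroup U] [InnerProductSpace ℝ U] [FiniteDimensional ℝ U]
  [NormedAddCommGroup V] [InnerProductSpace ℝ V]

/-- An injective linear map is bounded below, so the error in strict differentiability is at most a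
small multiple of `‖L (a - b)‖`; the distortion between `g` and `L` is then as close to `1` as
desired. -/
theorem exists_nhds_edist_compare {g : U → V} {L : U →L[ℝ] V} {x : U}
    (hg : HasStrictFDerivAt g L x) (hL : Function.Injective L) {s : NNReal} (hs : 1 < s) :
    ∃ W ∈ 𝓝 x, ∀ a ∈ W, ∀ b ∈ W, edist (g a) (g b) ≤ s * edist (L a) (L b) ∧
      edist (L a) (L b) ≤ s * edist (g a) (g b) := by
  obtain ⟨K, hK, hanti⟩ := L.toLinearMap.exists_antilipschitzWith (LinearMap.ker_eq_bot.2 hL)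
  have hs' : (1 : ℝ) < s := by exact_mod_cast hs
  have hK' : (0 : ℝ) < K := by exact_mod_cast hK
  -- This choice gives both `1 + δ ≤ s` and `1 - δ = s⁻¹`, which are the two comparisons.
  set δ : ℝ := 1 - (s : ℝ)⁻¹ with hδ
  have hδ0 : 0 < δ := by rw [hδ, sub_pos]; exact inv_lt_one_of_one_lt₀ hs'
  have hb := hg.isLittleO.def (div_pos hδ0 hK')
  rw [Filter.Eventually, nhds_prod_eq, Filter.mem_prod_self_iff] at hb
  obtain ⟨W, hW, hWs⟩ := hb
  refine ⟨W, hW, fun a ha b hb => ?_⟩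
  have h1 : ‖g a - g b - L (a - b)‖ ≤ δ / K * ‖a - b‖ := hWs (Set.mk_mem_prod ha hb)
  have h2 : ‖a - b‖ ≤ K * ‖L (a - b)‖ := by
    have := hanti.le_mul_dist a b
    simpa [dist_eq_norm, ← map_sub] using this
  have h3 : ‖g a - g b - L (a - b)‖ ≤ δ * ‖L (a - b)‖ := by
    calc _ ≤ _ := h1
      _ ≤ δ / K * (K * ‖L (a - b)‖) := by gcongr
      _ = _ := by field_simp
  have h4 : ‖g a - g b‖ ≤ s * ‖L (a - b)‖ := by
    have e1 : ‖g a - g b‖ ≤ ‖g a - g b - L (a - b)‖ + ‖L (a - b)‖ := by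
      simpa using norm_add_le (g a - g b - L (a - b)) (L (a - b))
    have : 1 + δ ≤ s := by
      have : (s : ℝ) * (s : ℝ)⁻¹ = 1 := mul_inv_cancel₀ (by positivity)
      have h0 : (0 : ℝ) < (s : ℝ)⁻¹ := by positivity
      rw [hδ]; nlinarith
    nlinarith [norm_nonneg (L (a - b))]
  have h5 : ‖L (a - b)‖ ≤ s * ‖g a - g b‖ := by
    have e1 : ‖L (a - b)‖ ≤ ‖g a - g b‖ + ‖g a - g b - L (a - b)‖ := by
      have := norm_sub_le (g a - g b) (g a - g b - L (a - b))
      simpa using this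
    have e2 : (s : ℝ)⁻¹ * ‖L (a - b)‖ ≤ ‖g a - g b‖ := by
      rw [hδ] at h3; linarith
    rw [inv_mul_le_iff₀ (by positivity)] at e2
    exact e2
  constructor
  · rw [edist_nndist, edist_nndist]
    norm_cast
    rw [← NNReal.coe_le_coe]
    simpa [dist_eq_norm, ← map_sub] using h4
  · rw [edist_nndist, edist_nndist]
    norm_cast
    rw [← NNReal.coe_le_coe]
    simpa [dist_eq_norm, ← map_sub] using h5

variable [MeasurableSpace U] [BorelSpace U] [MeasurableSpace V] [BorelSpace V]

/-- The area formula for an injective immersion of a Euclidean space, with a continuous Jacobian. -/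
theorem euclideanHausdorffMeasure_restrict_range {g : U → V} {g' : U → U →L[ℝ] V} {J : U → ℝ}
    (hg : ∀ x, HasStrictFDerivAt g (g' x) x) (hinj : ∀ x, Function.Injective (g' x))
    (hemb : MeasurableEmbedding g) (hJ : ∀ x, J x = (g' x).toLinearMap.normDet)
    (hJc : Continuous J) :
    (μHE[Module.finrank ℝ U]).restrict (Set.range g)
      = (volume.withDensity fun x => ENNReal.ofReal (J x)).map g := by
  set d := Module.finrank ℝ U
  set μ : Measure U := (μHE[d] : Measure V).comap g
  set ν : Measure U := volume.withDensity fun x => ENNReal.ofReal (J x)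
  have hμ : ∀ A, μ A = μHE[d] (g '' A) := fun A => hemb.comap_apply _ _
  have hJpos : ∀ x, 0 < J x := by
    intro x
    rw [hJ]
    refine lt_of_le_of_ne (LinearMap.normDet_nonneg _) (Ne.symm ?_)
    rw [Ne, LinearMap.normDet_eq_zero_iff_ker_ne_bot, not_not]
    exact LinearMap.ker_eq_bot.2 (hinj x)
  -- In the exponent `d + 1`, `d` factors come from replacing `g` by its derivative at `x` in a
  -- `d`-dimensional measure, and one from replacing `J y` by `J x`.
  have hloc : ∀ s : NNReal, 1 < s → ∀ x, ∃ W ∈ 𝓝 x, ∀ A ⊆ W, MeasurableSet A →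
      μ A ≤ ((s : ENNReal) ^ (d + 1) • ν) A ∧ ν A ≤ ((s : ENNReal) ^ (d + 1) • μ) A := by
    intro s hs x
    have hs' : (1 : ℝ) < s := by exact_mod_cast hs
    obtain ⟨W, hW, hcmp⟩ := exists_nhds_edist_compare (hg x) (hinj x) hs
    have h1 : ∀ᶠ y in 𝓝 x, J y < s * J x :=
      hJc.continuousAt.eventually_lt continuousAt_const (by nlinarith [hJpos x])
    have h2 : ∀ᶠ y in 𝓝 x, J x < s * J y :=
      continuousAt_const.eventually_lt (hJc.const_mul (s : ℝ)).continuousAt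
        (by nlinarith [hJpos x])
    have hdens : ∀ a b : ℝ, a < s * b → ENNReal.ofReal a ≤ s * ENNReal.ofReal b := by
      intro a b hab
      calc ENNReal.ofReal a ≤ ENNReal.ofReal (s * b) := ENNReal.ofReal_le_ofReal hab.le
        _ = _ := by rw [ENNReal.ofReal_mul (by positivity), ENNReal.ofReal_coe_nnreal]
    refine ⟨W ∩ ({y | J y < s * J x} ∩ {y | J x < s * J y}),
      inter_mem hW (inter_mem h1 h2), fun A hA hAm => ?_⟩
    have hlin : μHE[d] (g' x '' A) = ENNReal.ofReal (J x) * volume A := by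
      rw [hJ]
      exact LinearMap.euclideanHausdorffMeasure_image_eq_normDet_mul_volume
        (g' x).toLinearMap A
    have hνA : ν A = ∫⁻ y in A, ENNReal.ofReal (J y) := withDensity_apply _ hAm
    have e1 : μ A ≤ (s : ENNReal) ^ d * (ENNReal.ofReal (J x) * volume A) := by
      rw [hμ, ← hlin]
      exact euclideanHausdorffMeasure_image_le_of_edist_le d
        fun a ha b hb => (hcmp a (hA ha).1 b (hA hb).1).1
    have e2 : ENNReal.ofReal (J x) * volume A ≤ (s : ENNReal) ^ d * μ A := by
      rw [hμ, ← hlin]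
      exact euclideanHausdorffMeasure_image_le_of_edist_le d
        fun a ha b hb => (hcmp a (hA ha).1 b (hA hb).1).2
    have e3 : ENNReal.ofReal (J x) * volume A ≤ s * ν A := by
      rw [hνA, ← lintegral_const_mul _ (by fun_prop), ← setLIntegral_const]
      exact setLIntegral_mono (by fun_prop) fun y hy => hdens _ _ (hA hy).2.2
    have e4 : ν A ≤ s * (ENNReal.ofReal (J x) * volume A) := by
      rw [hνA, ← mul_assoc, ← setLIntegral_const]
      exact setLIntegral_mono (by fun_prop) fun y hy => hdens _ _ (hA hy).2.1
    simp only [Measure.smul_apply, smul_eq_mul]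
    constructor
    · calc μ A ≤ _ := e1
        _ ≤ (s : ENNReal) ^ d * (s * ν A) := by gcongr
        _ = _ := by ring
    · calc ν A ≤ _ := e4
        _ ≤ s * ((s : ENNReal) ^ d * μ A) := by gcongr
        _ = _ := by ring
  -- Letting `s` decrease to `1` removes the factor.
  have hle : ∀ m₁ m₂ : Measure U, (∀ s : NNReal, 1 < s → m₁ ≤ (s : ENNReal) ^ (d + 1) • m₂) →
      m₁ ≤ m₂ := by
    intro m₁ m₂ h A
    have ht : Tendsto (fun s : NNReal => (s : ENNReal) ^ (d + 1) * m₂ A) (𝓝[>] 1)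
        (𝓝 (1 * m₂ A)) := by
      refine ENNReal.Tendsto.mul_const ?_ (Or.inl one_ne_zero)
      have : Tendsto (fun s : NNReal => (s : ENNReal) ^ (d + 1)) (𝓝 1)
          (𝓝 ((1 : ENNReal) ^ (d + 1))) := by
        refine ENNReal.Tendsto.pow ?_
        exact (ENNReal.continuous_coe.tendsto 1)
      rw [one_pow] at this
      exact this.mono_left nhdsWithin_le_nhds
    rw [one_mul] at ht
    exact ge_of_tendsto ht (eventually_nhdsWithin_of_forall fun s hs => h s hs A)
  have hμν : μ = ν := le_antisymm
    (hle _ _ fun s hs => measure_le_of_locally_le fun x =>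
      let ⟨W, hW, h⟩ := hloc s hs x; ⟨W, hW, fun A hA hAm => (h A hA hAm).1⟩)
    (hle _ _ fun s hs => measure_le_of_locally_le fun x =>
      let ⟨W, hW, h⟩ := hloc s hs x; ⟨W, hW, fun A hA hAm => (h A hA hAm).2⟩)
  rw [← hμν, hemb.map_comap]

end AreaFormula

end Hypersurface

end

/-! ### Hypersurfaces as local graphs -/

noncomputable section

namespace Hypersurface

/-- The Euclidean space `ℝ^n` of parameters of a graph. -/
abbrev Base (n : ℕ) : Type := EuclideanSpace ℝ (Fin n)

/-- An orthogonal splitting of `ℝ^{n+1}` into a copy of `ℝ^n` and the line of a unit vector. -/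
structure Frame (n : ℕ) where
  /-- the unit vector -/
  e : Space n
  /-- the embedding of `ℝ^n` -/
  ι : Base n →ₗᵢ[ℝ] Space n
  norm_e : ‖e‖ = 1
  inner_e : ∀ v, inner ℝ e (ι v) = 0
  decomp : ∀ z, ∃ v, z = ι v + (inner ℝ e z : ℝ) • e

namespace Frame

variable {n : ℕ} (F : Frame n)

/-- The orthogonal projection onto `ℝ^n`. -/
def π : Space n →L[ℝ] Base n := ContinuousLinearMap.adjoint F.ι.toContinuousLinearMap

theorem inner_π (v : Base n) (z : Space n) : inner ℝ v (F.π z) = inner ℝ (F.ι v) z := by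
  rw [π, ContinuousLinearMap.adjoint_inner_right]; rfl

theorem inner_e_e : inner ℝ F.e F.e = (1 : ℝ) := by
  rw [real_inner_self_eq_norm_sq, F.norm_e]; norm_num

theorem inner_ι_e (v : Base n) : inner ℝ (F.ι v) F.e = (0 : ℝ) := by
  rw [real_inner_comm, F.inner_e]

@[simp] theorem π_ι (v : Base n) : F.π (F.ι v) = v := by
  refine ext_inner_left ℝ fun w => ?_
  rw [F.inner_π, F.ι.inner_map_map]

@[simp] theorem π_e : F.π F.e = 0 := by
  refine ext_inner_left ℝ fun w => ?_
  rw [F.inner_π, inner_ι_e, inner_zero_right]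

theorem ι_π_add (z : Space n) : F.ι (F.π z) + (inner ℝ F.e z : ℝ) • F.e = z := by
  obtain ⟨v, hv⟩ := F.decomp z
  have : F.π z = v := by rw [hv]; simp
  rw [this, ← hv]

theorem norm_π_le (z : Space n) : ‖F.π z‖ ≤ ‖z‖ := by
  have h := F.inner_π (F.π z) z
  rw [real_inner_self_eq_norm_sq] at h
  have h2 := real_inner_le_norm (F.ι (F.π z)) z
  rw [F.ι.norm_map] at h2
  rcases (norm_nonneg (F.π z)).eq_or_lt with h0 | h0
  · rw [← h0]; exact norm_nonneg _
  · nlinarith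

/-- A frame whose line is spanned by a given nonzero vector. -/
theorem exists_frame {v : Space n} (hv : v ≠ 0) : ∃ F : Frame n, F.e = ‖v‖⁻¹ • v := by
  have : Fact (Module.finrank ℝ (Space n) = n + 1) := ⟨by simp⟩
  let b := OrthonormalBasis.fromOrthogonalSpanSingleton (𝕜 := ℝ) n hv
  have hv' : ‖v‖ ≠ 0 := norm_ne_zero_iff.2 hv
  refine ⟨⟨‖v‖⁻¹ • v, (Submodule.subtypeₗᵢ _).comp b.repr.symm.toLinearIsometry, ?_, ?_, ?_⟩, rfl⟩
  · rw [norm_smul, norm_inv, norm_norm, inv_mul_cancel₀ hv']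
  · intro w
    have := (Submodule.mem_orthogonal_singleton_iff_inner_right (𝕜 := ℝ)).1 (b.repr.symm w).2
    rw [inner_smul_left]
    simp [this]
  · intro z
    have hz : z - (inner ℝ (‖v‖⁻¹ • v) z : ℝ) • (‖v‖⁻¹ • v) ∈ (Submodule.span ℝ {v})ᗮ := by
      rw [Submodule.mem_orthogonal_singleton_iff_inner_right]
      simp only [inner_sub_right, inner_smul_right, inner_smul_left, real_inner_self_eq_norm_sq]
      simp
      field_simp
      simp
    refine ⟨b.repr ⟨_, hz⟩, ?_⟩
    simp

/-- The parametrization of the graph of `u`. -/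
def graphMap (u : Base n → ℝ) (y : Base n) : Space n := F.ι y + u y • F.e

/-- The derivative of `graphMap` when `L` is that of `u`. -/
def graphDeriv (L : Base n →L[ℝ] ℝ) : Base n →L[ℝ] Space n :=
  F.ι.toContinuousLinearMap + L.smulRight F.e

theorem graphDeriv_apply (L : Base n →L[ℝ] ℝ) (v : Base n) :
    F.graphDeriv L v = F.ι v + L v • F.e := rfl

variable {u : Base n → ℝ}

@[simp] theorem π_graphMap (y : Base n) : F.π (F.graphMap u y) = y := by simp [graphMap]

@[simp] theorem π_graphDeriv (L : Base n →L[ℝ] ℝ) (v : Base n) : F.π (F.graphDeriv L v) = v := by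
  simp [graphDeriv_apply]

theorem inner_e_graphMap (y : Base n) : inner ℝ F.e (F.graphMap u y) = u y := by
  simp [graphMap, inner_add_right, inner_smul_right, F.inner_e, F.norm_e]

theorem mem_range_graphMap {z : Space n} :
    z ∈ Set.range (F.graphMap u) ↔ u (F.π z) = inner ℝ F.e z := by
  constructor
  · rintro ⟨y, rfl⟩
    rw [π_graphMap, inner_e_graphMap]
  · intro h
    exact ⟨F.π z, by rw [graphMap, h, ι_π_add]⟩

theorem graphMap_π {z : Space n} (hz : z ∈ Set.range (F.graphMap u)) :
    F.graphMap u (F.π z) = z := by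
  obtain ⟨y, rfl⟩ := hz; simp

theorem contDiff_graphMap {m : ℕ∞ω} (hu : ContDiff ℝ m u) : ContDiff ℝ m (F.graphMap u) :=
  F.ι.contDiff.add (hu.smul contDiff_const)

theorem hasStrictFDerivAt_graphMap {L : Base n →L[ℝ] ℝ} {y : Base n}
    (hu : HasStrictFDerivAt u L y) : HasStrictFDerivAt (F.graphMap u) (F.graphDeriv L) y :=
  F.ι.toContinuousLinearMap.hasStrictFDerivAt.add (hu.smul_const F.e)

/-- Through this bound a singular weight `|x|^(-b)` on a graph is dominated by `|y|^(-b)` on `ℝ^n`.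
-/
theorem norm_le_norm_graphMap (y : Base n) : ‖y‖ ≤ ‖F.graphMap u y‖ := by
  simpa using F.norm_π_le (F.graphMap u y)

/-- The projection `π` is a continuous left inverse on the whole ambient space. -/
theorem isClosedEmbedding_graphMap (hu : Continuous u) :
    IsClosedEmbedding (F.graphMap u) :=
  Function.LeftInverse.isClosedEmbedding (f := F.π) (fun y => F.π_graphMap y) F.π.continuous
    (F.ι.continuous.add (hu.smul continuous_const))

end Frame

/-- The `k`-th partial derivative. -/
def pderiv {n : ℕ} (k : Fin n) (u : Base n → ℝ) (y : Base n) : ℝ :=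
  fderiv ℝ u y (EuclideanSpace.single k 1)

theorem gradient_apply_eq_pderiv {n : ℕ} (u : Base n → ℝ) (y : Base n) (k : Fin n) :
    (∇ u y) k = pderiv k u y := by
  rw [pderiv, ← inner_gradient_left, EuclideanSpace.inner_single_right]
  simp

/-- The Jacobian `√(1 + |∇u|²)` of the parametrization of the graph of `u`. -/
def jac {n : ℕ} (u : Base n → ℝ) (y : Base n) : ℝ := √(1 + ∑ k, pderiv k u y ^ 2)

section

variable {n : ℕ} (u : Base n → ℝ) (y : Base n)

theorem one_le_jac_sq_aux : 0 < 1 + ∑ k, pderiv k u y ^ 2 :=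
  add_pos_of_pos_of_nonneg one_pos (Finset.sum_nonneg fun _ _ => sq_nonneg _)

theorem jac_pos : 0 < jac u y := Real.sqrt_pos.2 (one_le_jac_sq_aux u y)

theorem jac_sq : jac u y ^ 2 = 1 + ∑ k, pderiv k u y ^ 2 :=
  Real.sq_sqrt (one_le_jac_sq_aux u y).le

theorem norm_gradient_sq : ‖∇ u y‖ ^ 2 = ∑ k, pderiv k u y ^ 2 := by
  simp [EuclideanSpace.norm_sq_eq, gradient_apply_eq_pderiv]

/-- The Gram matrix of the columns of the derivative is `1 + c cᵀ` with `c = ∇u`, a rank-one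
perturbation of the identity with determinant `1 + |c|²`. -/
theorem normDet_graphDeriv (F : Frame n) :
    (F.graphDeriv (fderiv ℝ u y)).toLinearMap.normDet = jac u y := by
  refine (Real.sqrt_eq_iff_eq_sq (one_le_jac_sq_aux u y).le
    (LinearMap.normDet_nonneg _)).2 ?_ |>.symm
  have h := LinearMap.normDet_sq_eq_det_gram (F.graphDeriv (fderiv ℝ u y)).toLinearMap
    (EuclideanSpace.basisFun (Fin n) ℝ)
  rw [RCLike.ofReal_real_eq_id, id] at h
  rw [h]
  set c : Fin n → ℝ := fun k => pderiv k u y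
  have hm : Matrix.gram ℝ (fun k => (F.graphDeriv (fderiv ℝ u y)).toLinearMap
      (EuclideanSpace.basisFun (Fin n) ℝ k))
      = 1 + Matrix.replicateCol Unit c * Matrix.replicateRow Unit c := by
    ext i j
    simp only [Matrix.gram, Matrix.of_apply, ContinuousLinearMap.coe_coe, F.graphDeriv_apply,
      EuclideanSpace.basisFun_apply, inner_add_left, inner_add_right, inner_smul_left,
      inner_smul_right, F.inner_e, F.inner_ι_e, F.inner_e_e, LinearIsometry.inner_map_map,
      Matrix.add_apply, Matrix.mul_apply, Matrix.replicateCol_apply, Matrix.replicateRow_apply]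
    simp [c, pderiv, Matrix.one_apply, EuclideanSpace.inner_single_left, mul_comm]
  rw [hm, Matrix.det_one_add_mul_comm]
  simp [Matrix.det_unique, Matrix.mul_apply, c, sq]

end

theorem contDiff_pderiv {n : ℕ} {m : ℕ∞ω} {u : Base n → ℝ} (hu : ContDiff ℝ (m + 1) u)
    (k : Fin n) : ContDiff ℝ m (pderiv k u) :=
  (hu.fderiv_right le_rfl).clm_apply contDiff_const

theorem contDiff_jac {n : ℕ} {m : ℕ∞ω} {u : Base n → ℝ} (hu : ContDiff ℝ (m + 1) u) :
    ContDiff ℝ m (jac u) := by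
  refine ContDiff.sqrt ?_ fun y => (one_le_jac_sq_aux u y).ne'
  exact contDiff_const.add (ContDiff.sum fun k _ => (contDiff_pderiv hu k).pow 2)

theorem hausdorff_restrict_graph {n : ℕ} (F : Frame n) {u : Base n → ℝ} (hu : ContDiff ℝ 1 u) :
    (μHE[n] : Measure (Space n)).restrict (Set.range (F.graphMap u))
      = (volume.withDensity fun y => ENNReal.ofReal (jac u y)).map (F.graphMap u) := by
  have h := euclideanHausdorffMeasure_restrict_range (U := Base n) (V := Space n)
    (g := F.graphMap u) (g' := fun y => F.graphDeriv (fderiv ℝ u y)) (J := jac u)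
    (fun y => F.hasStrictFDerivAt_graphMap (hu.contDiffAt.hasStrictFDerivAt one_ne_zero))
    (fun y => Function.LeftInverse.injective (g := F.π) fun v => F.π_graphDeriv _ v)
    (F.isClosedEmbedding_graphMap hu.continuous).measurableEmbedding
    (fun y => (normDet_graphDeriv u y F).symm) (contDiff_jac (m := 0) (by simpa using hu)).continuous
  simpa using h

theorem contDiff_of_mem_tsupport {E G : Type*} [NormedAddCommGroup E] [NormedSpace ℝ E]
    [NormedAddCommGroup G] [NormedSpace ℝ G] {m : ℕ∞ω} {f : E → G}
    (h : ∀ x ∈ tsupport f, ContDiffAt ℝ m f x) : ContDiff ℝ m f := by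
  refine contDiff_iff_contDiffAt.2 fun x => ?_
  by_cases hx : x ∈ tsupport f
  · exact h x hx
  · exact contDiffAt_const.congr_of_eventuallyEq (notMem_tsupport_iff_eventuallyEq.1 hx)

/-- Multiplying by a bump function makes a germ global, so that a local implicit function gives a
graph over all of `ℝ^n`. The order `m` is finite because only then does `ContDiffAt` at `y`
propagate to a neighbourhood. -/
theorem exists_contDiff_eventuallyEq {n : ℕ} {m : ℕ} {φ : Base n → ℝ} {y : Base n}
    (hφ : ContDiffAt ℝ m φ y) : ∃ u, ContDiff ℝ m u ∧ u =ᶠ[𝓝 y] φ := by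
  have h : ∀ᶠ z in 𝓝 y, ContDiffAt ℝ m φ z := hφ.eventually (by simp)
  obtain ⟨r, hr, hball⟩ := Metric.eventually_nhds_iff_ball.1 h
  let χ : ContDiffBump y := ⟨r / 4, r / 2, by linarith, by linarith⟩
  refine ⟨fun z => χ z * φ z, ?_, ?_⟩
  · refine contDiff_of_mem_tsupport fun z hz => ?_
    have hz' : z ∈ tsupport χ := tsupport_mul_subset_left hz
    rw [χ.tsupport_eq] at hz'
    refine χ.contDiff.contDiffAt.mul (hball z ?_)
    rw [Metric.mem_ball]
    have := Metric.mem_closedBall.1 hz'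
    change dist z y ≤ r / 2 at this
    linarith
  · filter_upwards [χ.eventuallyEq_one] with z hz
    rw [hz]; simp

/-- Implicit function theorem in the frame whose line is spanned by `∇ f x`: there the derivative of
`f` along `e` is `‖∇ f x‖ ≠ 0`. Regularity `C²` of `u` is enough, since the curvature involves two
derivatives. -/
theorem IsSmoothHypersurface.exists_graph {n : ℕ} {M : Set (Space n)}
    (hM : IsSmoothHypersurface M) {x : Space n} (hx : x ∈ M) :
    ∃ (F : Frame n) (u : Base n → ℝ), ContDiff ℝ 2 u ∧
      ∀ᶠ z in 𝓝 x, z ∈ M ↔ z ∈ Set.range (F.graphMap u) := by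
  obtain ⟨U, hU, hxU, f, hf, hgrad, hMU⟩ := hM x hx
  have hUx : U ∈ 𝓝 x := hU.mem_nhds hxU
  obtain ⟨F, hF⟩ := Frame.exists_frame (hgrad x hxU)
  set q : Base n × ℝ → Space n := fun v => F.ι v.1 + v.2 • F.e with hq
  have hqs : ContDiff ℝ ∞ q :=
    (F.ι.contDiff.comp contDiff_fst).add (contDiff_snd.smul contDiff_const)
  set v₀ : Base n × ℝ := (F.π x, inner ℝ F.e x) with hv₀
  have hq₀ : q v₀ = x := F.ι_π_add x
  have hfx : ContDiffAt ℝ ∞ f x := hf.contDiffAt hUx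
  have hfq : ContDiffAt ℝ 2 (f ∘ q) v₀ := by
    refine ContDiffAt.of_le (n := ∞) ?_ (WithTop.coe_le_coe.2 le_top)
    exact ContDiffAt.comp _ (by rw [hq₀]; exact hfx) hqs.contDiffAt
  have hder : (fderiv ℝ (f ∘ q) v₀ ∘L .inr ℝ (Base n) ℝ) 1 = ‖∇ f x‖ := by
    have h1 : HasFDerivAt q ((F.ι.toContinuousLinearMap.comp (.fst ℝ (Base n) ℝ)) +
        (ContinuousLinearMap.snd ℝ (Base n) ℝ).smulRight F.e) v₀ :=
      (F.ι.toContinuousLinearMap.hasFDerivAt.comp v₀ hasFDerivAt_fst).add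
        (hasFDerivAt_snd.smul_const F.e)
    have h2 : HasFDerivAt f (fderiv ℝ f x) (q v₀) := by
      rw [hq₀]; exact (hfx.differentiableAt (by simp)).hasFDerivAt
    rw [(h2.comp v₀ h1).fderiv]
    simp only [ContinuousLinearMap.comp_apply, add_apply,
      ContinuousLinearMap.inr_apply, ContinuousLinearMap.coe_fst', map_zero,
      ContinuousLinearMap.smulRight_apply, ContinuousLinearMap.coe_snd', one_smul, zero_add]
    rw [← inner_gradient_left, hF, inner_smul_right, real_inner_self_eq_norm_sq]
    have := norm_ne_zero_iff.2 (hgrad x hxU)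
    field_simp
  have hinv : (fderiv ℝ (f ∘ q) v₀ ∘L .inr ℝ (Base n) ℝ).IsInvertible := by
    have h0 : ‖∇ f x‖ ≠ 0 := norm_ne_zero_iff.2 (hgrad x hxU)
    refine ⟨ContinuousLinearEquiv.unitsEquivAut ℝ (Units.mk0 _ h0), ?_⟩
    ext
    simp [← hder]
  obtain ⟨u, hu, hueq⟩ := exists_contDiff_eventuallyEq (m := 2)
    (hfq.contDiffAt_implicitFunction two_ne_zero hinv)
  refine ⟨F, u, hu, ?_⟩
  have hp : ContinuousAt (fun z => (F.π z, (inner ℝ F.e z : ℝ))) x := by fun_prop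
  have e1 := hp.eventually (hfq.eventually_apply_eq_iff_implicitFunction two_ne_zero hinv)
  have e2 := (F.π.continuous.continuousAt (x := x)).eventually hueq
  have hx0 : f x = 0 := by
    have : x ∈ M ∩ U := ⟨hx, hxU⟩
    rw [hMU] at this
    exact this.2
  filter_upwards [e1, e2, hUx] with z h1 h2 h3
  have hzM : z ∈ M ↔ f z = 0 := by
    constructor
    · intro hz
      have : z ∈ M ∩ U := ⟨hz, h3⟩
      rw [hMU] at this
      exact this.2
    · intro hz
      have : z ∈ {y ∈ U | f y = 0} := ⟨h3, hz⟩
      rw [← hMU] at this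
      exact this.1
  rw [hzM, F.mem_range_graphMap, h2, ← h1]
  simp only [Function.comp_apply, hq₀, hx0]
  rw [show q (F.π z, inner ℝ F.e z) = z from F.ι_π_add z]

end Hypersurface

end

/-! ### Normal, tangential gradient and mean curvature in graph coordinates -/

noncomputable section

namespace Hypersurface

/-- The projection of `v` orthogonally to the unit vector `ν`. -/
def tproj {n : ℕ} (ν v : Space n) : Space n := v - (inner ℝ v ν : ℝ) • ν

theorem tproj_neg {n : ℕ} (ν v : Space n) : tproj (-ν) v = tproj ν v := by
  simp [tproj]

theorem tproj_sub {n : ℕ} (ν v w : Space n) : tproj ν (v - w) = tproj ν v - tproj ν w := by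
  simp only [tproj, inner_sub_left, sub_smul]; abel

theorem tproj_add {n : ℕ} (ν v w : Space n) : tproj ν (v + w) = tproj ν v + tproj ν w := by
  simp only [tproj, inner_add_left, add_smul]; abel

theorem tproj_smul {n : ℕ} (ν v : Space n) (c : ℝ) : tproj ν (c • v) = c • tproj ν v := by
  simp only [tproj, inner_smul_left, smul_sub, smul_smul]; simp

theorem tproj_smul_self {n : ℕ} {ν : Space n} (hν : ‖ν‖ = 1) (c : ℝ) : tproj ν (c • ν) = 0 := by
  simp [tproj, inner_smul_left, hν]

theorem norm_tproj_le {n : ℕ} {ν : Space n} (hν : ‖ν‖ = 1) (v : Space n) :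
    ‖tproj ν v‖ ≤ ‖v‖ := by
  have h : ‖tproj ν v‖ ^ 2 = ‖v‖ ^ 2 - (inner ℝ v ν : ℝ) ^ 2 := by
    rw [tproj, norm_sub_sq_real, inner_smul_right, norm_smul, hν, mul_one, Real.norm_eq_abs,
      sq_abs]
    ring
  refine (sq_le_sq₀ (norm_nonneg _) (norm_nonneg _)).1 ?_
  rw [h]
  nlinarith [sq_nonneg (inner ℝ v ν : ℝ)]

/-- A derivative within `M` is unique along the tangent cone. This is what makes tangential
quantities independent of the extension off `M`. -/
theorem hasFDerivWithinAt_unique_of_eventuallyEq {n : ℕ} {M : Set (Space n)} {x : Space n}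
    (hx : x ∈ M) {f g : Space n → ℝ} (hf : DifferentiableAt ℝ f x) (hg : DifferentiableAt ℝ g x)
    (hfg : ∀ᶠ y in 𝓝[M] x, f y = g y) {w : Space n} (hw : w ∈ tangentConeAt ℝ M x) :
    fderiv ℝ f x w = fderiv ℝ g x w := by
  have h1 : HasFDerivWithinAt f (fderiv ℝ f x) M x := hf.hasFDerivAt.hasFDerivWithinAt
  have h2 : HasFDerivWithinAt f (fderiv ℝ g x) M x :=
    hg.hasFDerivAt.hasFDerivWithinAt.congr_of_eventuallyEq hfg (hfg.self_of_nhdsWithin hx)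
  exact h1.unique_on h2 hw

/-- The unit normal `(e - ∇u) / √(1 + |∇u|²)` to the graph of `u`. -/
def Frame.normal {n : ℕ} (F : Frame n) (u : Base n → ℝ) (y : Base n) : Space n :=
  (jac u y)⁻¹ • (F.e - F.ι (∇ u y))

/-- The mean curvature of the graph of `u` with respect to `Frame.normal`. -/
def graphCurv {n : ℕ} (u : Base n → ℝ) (y : Base n) : ℝ :=
  -∑ k, pderiv k (fun z => pderiv k u z / jac u z) y

section Normal

variable {n : ℕ} (F : Frame n) {u : Base n → ℝ}

theorem Frame.norm_normal (y : Base n) : ‖F.normal u y‖ = 1 := by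
  have hj := jac_pos u y
  have h : ‖F.e - F.ι (∇ u y)‖ ^ 2 = jac u y ^ 2 := by
    rw [norm_sub_sq_real, F.inner_e, F.norm_e, F.ι.norm_map, norm_gradient_sq, jac_sq]; ring
  have h' : ‖F.e - F.ι (∇ u y)‖ = jac u y := by
    rwa [sq_eq_sq₀ (norm_nonneg _) hj.le] at h
  rw [Frame.normal, norm_smul, h', norm_inv, Real.norm_of_nonneg hj.le, inv_mul_cancel₀ hj.ne']

theorem contDiff_gradient {m : ℕ∞ω} (hu : ContDiff ℝ (m + 1) u) : ContDiff ℝ m (∇ u) :=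
  (InnerProductSpace.toDual ℝ (Base n)).symm.contDiff.comp (hu.fderiv_right le_rfl)

theorem Frame.contDiff_normal {m : ℕ∞ω} (hu : ContDiff ℝ (m + 1) u) :
    ContDiff ℝ m (F.normal u) :=
  ((contDiff_jac hu).inv fun y => (jac_pos u y).ne').smul
    (contDiff_const.sub (F.ι.contDiff.comp (contDiff_gradient hu)))

/-- A vector orthogonal to the graph is a multiple of the normal. -/
theorem Frame.eq_smul_normal {y : Base n} {w : Space n}
    (hw : ∀ v, inner ℝ w (F.graphDeriv (fderiv ℝ u y) v) = (0 : ℝ)) :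
    w = ((inner ℝ F.e w : ℝ) * jac u y) • F.normal u y := by
  have hj := (jac_pos u y).ne'
  rw [Frame.normal, smul_smul, mul_assoc, mul_inv_cancel₀ hj, mul_one]
  -- Orthogonality to every `ι v + (∂_v u) e` determines the horizontal part of `w` from its
  -- component along `e`.
  have h1 : F.π w = -((inner ℝ F.e w : ℝ) • ∇ u y) := by
    refine ext_inner_left ℝ fun v => ?_
    have := hw v
    rw [F.graphDeriv_apply, inner_add_right, inner_smul_right, ← inner_gradient_left,
      real_inner_comm, real_inner_comm F.e] at this
    rw [F.inner_π, inner_neg_right, inner_smul_right, real_inner_comm (∇ u y) v]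
    linarith
  conv_lhs => rw [← F.ι_π_add w, h1]
  rw [map_neg, map_smul, smul_sub]
  abel

end Normal

/-- Near `x ∈ M`, the set `M` is the graph of `u` in the frame `F`. -/
structure IsGraphNear {n : ℕ} (M : Set (Space n)) (F : Frame n) (u : Base n → ℝ)
    (x : Space n) : Prop where
  mem : x ∈ M
  contDiff : ContDiff ℝ 2 u
  eventually : ∀ᶠ z in 𝓝 x, z ∈ M ↔ z ∈ Set.range (F.graphMap u)

theorem IsSmoothHypersurface.exists_isGraphNear {n : ℕ} {M : Set (Space n)}
    (hM : IsSmoothHypersurface M) {x : Space n} (hx : x ∈ M) :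
    ∃ (F : Frame n) (u : Base n → ℝ), IsGraphNear M F u x :=
  let ⟨F, u, hu, h⟩ := hM.exists_graph hx
  ⟨F, u, hx, hu, h⟩

theorem contDiffAt_gradient {n : ℕ} {f : Space n → ℝ} {x : Space n} {m : ℕ∞ω}
    (hf : ContDiffAt ℝ (m + 1) f x) : ContDiffAt ℝ m (∇ f) x :=
  (InnerProductSpace.toDual ℝ (Space n)).symm.contDiff.contDiffAt.comp x
    (hf.fderiv_right le_rfl)

/-- The normalized gradient of a defining function is a witness, so the choice made in `localNormal`
has the required property. Its orthogonality to the tangent cone holds because the defining function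
vanishes on `M`. -/
theorem IsSmoothHypersurface.isUnitNormalFieldNear_localNormal {n : ℕ} {M : Set (Space n)}
    (hM : IsSmoothHypersurface M) {x : Space n} (hx : x ∈ M) :
    IsUnitNormalFieldNear M x (localNormal M x) := by
  refine Classical.epsilon_spec (p := IsUnitNormalFieldNear M x) ?_
  obtain ⟨U, hU, hxU, f, hf, hgrad, hMU⟩ := hM x hx
  have h0 : ‖∇ f x‖ ≠ 0 := norm_ne_zero_iff.2 (hgrad x hxU)
  have hfx : ContDiffAt ℝ ∞ (∇ f) x := contDiffAt_gradient (hf.contDiffAt (hU.mem_nhds hxU))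
  refine ⟨fun y => ‖∇ f y‖⁻¹ • ∇ f y,
    ((hfx.norm ℝ (hgrad x hxU)).inv h0).smul hfx, ?_⟩
  filter_upwards [self_mem_nhdsWithin, mem_nhdsWithin_of_mem_nhds (hU.mem_nhds hxU)] with y hy hyU
  refine ⟨?_, fun w hw => ?_⟩
  · rw [norm_smul, norm_inv, norm_norm, inv_mul_cancel₀ (norm_ne_zero_iff.2 (hgrad y hyU))]
  · have hz : ∀ z ∈ M ∩ U, f z = 0 := fun z hz => by rw [hMU] at hz; exact hz.2
    have hd : DifferentiableAt ℝ f y :=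
      (hf.contDiffAt (hU.mem_nhds hyU)).differentiableAt (by simp)
    have := hasFDerivWithinAt_unique_of_eventuallyEq hy hd (differentiableAt_const (0 : ℝ)) (by
      filter_upwards [self_mem_nhdsWithin, mem_nhdsWithin_of_mem_nhds (hU.mem_nhds hyU)]
        with z h1 h2 using hz z ⟨h1, h2⟩) hw
    rw [inner_smul_left, inner_gradient_left, this]
    simp

namespace IsGraphNear

variable {n : ℕ} {M : Set (Space n)} {F : Frame n} {u : Base n → ℝ} {x : Space n}
  (h : IsGraphNear M F u x)

include h

theorem eventually_isGraphNear : ∀ᶠ y in 𝓝[M] x, IsGraphNear M F u y := by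
  filter_upwards [self_mem_nhdsWithin,
    mem_nhdsWithin_of_mem_nhds (eventually_eventually_nhds.2 h.eventually)] with y hy hy'
  exact ⟨hy, h.contDiff, hy'⟩

theorem mem_range : x ∈ Set.range (F.graphMap u) := h.eventually.self_of_nhds.1 h.mem

theorem graphMap_π : F.graphMap u (F.π x) = x := F.graphMap_π h.mem_range

theorem nhdsWithin_eq : 𝓝[M] x = 𝓝[Set.range (F.graphMap u)] x :=
  nhdsWithin_eq_iff_eventuallyEq.2 (h.eventually.mono fun _ hz => propext hz)

/-- Only this inclusion into the tangent cone is needed: the vectors reached already form a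
hyperplane, so orthogonality to the cone confines a vector to the normal line. -/
theorem graphDeriv_mem_tangentConeAt (v : Base n) :
    F.graphDeriv (fderiv ℝ u (F.π x)) v ∈ tangentConeAt ℝ M x := by
  rw [tangentConeAt_congr h.nhdsWithin_eq, ← Set.image_univ]
  have hd := (F.hasStrictFDerivAt_graphMap (h.contDiff.contDiffAt.hasStrictFDerivAt
    (x := F.π x) two_ne_zero)).hasFDerivAt.hasFDerivWithinAt (s := Set.univ)
  have := HasFDerivWithinAt.mapsTo_tangent_cone hd (by simp : v ∈ tangentConeAt ℝ Set.univ (F.π x))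
  rwa [h.graphMap_π] at this

theorem eq_smul_normal {w : Space n} (hw : ∀ v ∈ tangentConeAt ℝ M x, inner ℝ w v = (0 : ℝ)) :
    ∃ c : ℝ, w = c • F.normal u (F.π x) :=
  ⟨_, F.eq_smul_normal fun v => hw _ (h.graphDeriv_mem_tangentConeAt v)⟩

theorem eq_or_eq_neg_normal {w : Space n} (hw : IsUnitNormalAt M x w) :
    w = F.normal u (F.π x) ∨ w = -F.normal u (F.π x) := by
  obtain ⟨c, rfl⟩ := h.eq_smul_normal hw.2
  have := hw.1
  rw [norm_smul, F.norm_normal, mul_one, Real.norm_eq_abs] at this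
  rcases eq_or_eq_neg_of_abs_eq this with rfl | rfl <;> simp

theorem continuousAt_normal : ContinuousAt (fun y => F.normal u (F.π y)) x :=
  ((F.contDiff_normal (m := 1) h.contDiff).continuous.comp F.π.continuous).continuousAt

/-- At each nearby point of `M` the two unit normals agree up to sign, and the sign is locally
constant because their inner product is continuous and equals `1` at `x` once the sign there is
matched. Agreement along `M` near `x`, not just at `x`, is needed to differentiate the normal. -/
theorem exists_sign (hM : IsSmoothHypersurface M) : ∃ σ : ℝ, (σ = 1 ∨ σ = -1) ∧
    ∀ᶠ y in 𝓝[M] x, localNormal M x y = σ • F.normal u (F.π y) := by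
  obtain ⟨hc, hn⟩ := hM.isUnitNormalFieldNear_localNormal h.mem
  obtain ⟨σ, hσ, hx⟩ : ∃ σ : ℝ, (σ = 1 ∨ σ = -1) ∧
      localNormal M x x = σ • F.normal u (F.π x) := by
    rcases h.eq_or_eq_neg_normal (hn.self_of_nhdsWithin h.mem) with h' | h'
    · exact ⟨1, Or.inl rfl, by simpa using h'⟩
    · exact ⟨-1, Or.inr rfl, by simpa using h'⟩
  refine ⟨σ, hσ, ?_⟩
  have hpos : ∀ᶠ y in 𝓝 x, 0 < (inner ℝ (localNormal M x y) (σ • F.normal u (F.π y)) : ℝ) := by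
    have hcont : ContinuousAt
        (fun y => (inner ℝ (localNormal M x y) (σ • F.normal u (F.π y)) : ℝ)) x :=
      hc.continuousAt.inner (h.continuousAt_normal.const_smul σ)
    refine continuousAt_const.eventually_lt hcont ?_
    rw [← hx, real_inner_self_eq_norm_sq, (hn.self_of_nhdsWithin h.mem).1]
    norm_num
  filter_upwards [hn, h.eventually_isGraphNear, mem_nhdsWithin_of_mem_nhds hpos] with y h1 h2 h3
  have hN := F.norm_normal (u := u) (F.π y)
  rcases h2.eq_or_eq_neg_normal h1 with h4 | h4 <;> rcases hσ with rfl | rfl <;>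
    rw [h4] at h3 ⊢ <;> simp [hN] at h3 ⊢ <;> linarith

theorem unitNormal_eq_or (hM : IsSmoothHypersurface M) :
    unitNormal M x = F.normal u (F.π x) ∨ unitNormal M x = -F.normal u (F.π x) :=
  h.eq_or_eq_neg_normal
    ((hM.isUnitNormalFieldNear_localNormal h.mem).2.self_of_nhdsWithin h.mem)

theorem tproj_unitNormal (hM : IsSmoothHypersurface M) (v : Space n) :
    tproj (unitNormal M x) v = tproj (F.normal u (F.π x)) v := by
  rcases h.unitNormal_eq_or hM with h' | h' <;> rw [h']
  exact tproj_neg _ _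

theorem ambientTangentialGradient_eq (hM : IsSmoothHypersurface M) (ψ : Space n → ℝ) :
    ambientTangentialGradient M ψ x = tproj (F.normal u (F.π x)) (∇ ψ x) :=
  h.tproj_unitNormal hM _

theorem ambientTangentialGradient_congr (hM : IsSmoothHypersurface M) {f g : Space n → ℝ}
    (hf : DifferentiableAt ℝ f x) (hg : DifferentiableAt ℝ g x)
    (hfg : ∀ᶠ y in 𝓝[M] x, f y = g y) :
    ambientTangentialGradient M f x = ambientTangentialGradient M g x := by
  rw [h.ambientTangentialGradient_eq hM, h.ambientTangentialGradient_eq hM, ← sub_eq_zero,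
    ← tproj_sub]
  obtain ⟨c, hc⟩ := h.eq_smul_normal (w := ∇ f x - ∇ g x) fun v hv => by
    rw [inner_sub_left, inner_gradient_left, inner_gradient_left,
      hasFDerivWithinAt_unique_of_eventuallyEq h.mem hf hg hfg hv, sub_self]
  rw [hc, tproj_smul_self (F.norm_normal _)]

theorem tangentialGradient_eq (hM : IsSmoothHypersurface M) {φ ψ : Space n → ℝ}
    (hψ : IsC1ExtensionNear M φ x ψ) :
    tangentialGradient M φ x = ambientTangentialGradient M ψ x := by
  have hs := Classical.epsilon_spec (p := IsC1ExtensionNear M φ x) ⟨ψ, hψ⟩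
  exact h.ambientTangentialGradient_congr hM (hs.1.differentiableAt one_ne_zero)
    (hψ.1.differentiableAt one_ne_zero) (hs.2.mp (hψ.2.mono fun y h1 h2 => by rw [h1, h2]))

omit h in
theorem gradient_comp_π {ψ : Base n → ℝ} (hψ : DifferentiableAt ℝ ψ (F.π x)) :
    ∇ (fun z => ψ (F.π z)) x = F.ι (∇ ψ (F.π x)) := by
  refine ext_inner_right ℝ fun v => ?_
  rw [inner_gradient_left, ← F.inner_π, inner_gradient_left]
  have := hψ.hasFDerivAt.comp x F.π.hasFDerivAt
  rw [show (fun z => ψ (F.π z)) = ψ ∘ F.π from rfl, this.fderiv]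
  rfl

theorem tangentialDivergence_congr (hM : IsSmoothHypersurface M) {Z W : Space n → Space n}
    (hZ : DifferentiableAt ℝ Z x) (hW : DifferentiableAt ℝ W x)
    (hZW : ∀ᶠ y in 𝓝[M] x, Z y = W y) :
    tangentialDivergence M Z x = tangentialDivergence M W x := by
  refine Finset.sum_congr rfl fun i _ => ?_
  rw [h.ambientTangentialGradient_congr hM (f := fun y => Z y i) (g := fun y => W y i)
    (by fun_prop) (by fun_prop) (hZW.mono fun y hy => by rw [hy])]

/-- The tangential divergence is the full divergence, a trace, minus the normal derivative of the
normal component. For a field constant along `e` the derivative factors through `π`, and the trace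
can be computed on `ℝ^n`. -/
theorem tangentialDivergence_comp_π (hM : IsSmoothHypersurface M) {Z : Base n → Space n}
    (hZ : DifferentiableAt ℝ Z (F.π x)) :
    tangentialDivergence M (fun y => Z (F.π y)) x
      = ∑ k, (inner ℝ (F.ι (EuclideanSpace.single k 1))
          (fderiv ℝ Z (F.π x) (EuclideanSpace.single k 1)) : ℝ)
        - inner ℝ (fderiv ℝ Z (F.π x) (F.π (F.normal u (F.π x)))) (F.normal u (F.π x)) := by
  set N := F.normal u (F.π x)
  set A := fderiv ℝ Z (F.π x)
  have hA : ∀ i v, fderiv ℝ (fun y => Z y i) (F.π x) v = A v i := by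
    intro i v
    have h1 : HasFDerivAt (fun y => Z y i) ((EuclideanSpace.proj i).comp A) (F.π x) :=
      (EuclideanSpace.proj i : Space n →L[ℝ] ℝ).hasFDerivAt.comp _ hZ.hasFDerivAt
    rw [h1.fderiv]; rfl
  have hterm : ∀ i, ambientTangentialGradient M (fun y => Z (F.π y) i) x i
      = inner ℝ (EuclideanSpace.single i (1 : ℝ)) (A (F.π (EuclideanSpace.single i 1)))
        - A (F.π N) i * N i := by
    intro i
    rw [h.ambientTangentialGradient_eq hM,
      gradient_comp_π (ψ := fun z => Z z i) (by fun_prop)]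
    have e1 : ∀ w, inner ℝ (F.ι (∇ (fun z => Z z i) (F.π x))) w = A (F.π w) i := by
      intro w
      rw [← F.inner_π, inner_gradient_left, hA]
    have e2 : (F.ι (∇ (fun z => Z z i) (F.π x))) i = A (F.π (EuclideanSpace.single i 1)) i := by
      rw [← e1, EuclideanSpace.inner_single_right]; simp
    simp only [tproj, PiLp.sub_apply, PiLp.smul_apply, smul_eq_mul, e1, e2]
    rw [EuclideanSpace.inner_single_left]
    simp [N]
  rw [tangentialDivergence, Finset.sum_congr rfl fun i _ => hterm i, Finset.sum_sub_distrib]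
  congr 1
  -- The identity `tr (A π) = tr (π A)` passes from a sum over the `n + 1` ambient coordinates to
  -- one over the `n` base coordinates.
  · have t1 := LinearMap.trace_eq_sum_inner (A ∘L F.π).toLinearMap
      (EuclideanSpace.basisFun (Fin (n + 1)) ℝ)
    have t2 := LinearMap.trace_eq_sum_inner (F.π ∘L A).toLinearMap
      (EuclideanSpace.basisFun (Fin n) ℝ)
    have t3 := LinearMap.trace_comp_comm' A.toLinearMap F.π.toLinearMap
    have t4 : LinearMap.trace ℝ _ (A ∘L F.π).toLinearMap
      = LinearMap.trace ℝ _ (F.π ∘L A).toLinearMap := t3.symm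
    rw [t1, t2] at t4
    simp only [EuclideanSpace.basisFun_apply, ContinuousLinearMap.coe_coe,
      ContinuousLinearMap.comp_apply, F.inner_π] at t4
    exact t4
  · rw [PiLp.inner_apply]
    simp [mul_comm]

/-- The normal term of the divergence vanishes because `|N| = 1` makes every derivative of `N`
orthogonal to `N`; the horizontal components of `N` are `-∂_k u / J`. The unknown sign enters once
in `H` and once in `ν`, and cancels. -/
theorem meanCurvatureVector_eq (hM : IsSmoothHypersurface M) :
    meanCurvatureVector M x = graphCurv u (F.π x) • F.normal u (F.π x) := by
  obtain ⟨σ, hσ, hloc⟩ := h.exists_sign hM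
  have hNd : Differentiable ℝ (F.normal u) :=
    (F.contDiff_normal (m := 1) h.contDiff).differentiable one_ne_zero
  have hx : unitNormal M x = σ • F.normal u (F.π x) := hloc.self_of_nhdsWithin h.mem
  have hH : meanCurvature M x = σ * graphCurv u (F.π x) := by
    rw [meanCurvature, h.tangentialDivergence_congr hM
      ((hM.isUnitNormalFieldNear_localNormal h.mem).1.differentiableAt (by simp))
      (W := fun y => σ • F.normal u (F.π y)) (by fun_prop) hloc,
      h.tangentialDivergence_comp_π hM (Z := fun y => σ • F.normal u y) (by fun_prop)]
    rw [fderiv_fun_const_smul hNd.differentiableAt]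
    have hself : ∀ v, (inner ℝ (fderiv ℝ (F.normal u) (F.π x) v) (F.normal u (F.π x)) : ℝ)
        = 0 := by
      intro v
      have hd := (hNd (F.π x)).hasFDerivAt.inner ℝ (hNd (F.π x)).hasFDerivAt
      have hconst : (fun y => (inner ℝ (F.normal u y) (F.normal u y) : ℝ)) = fun _ => 1 := by
        funext y; rw [real_inner_self_eq_norm_sq, F.norm_normal]; norm_num
      rw [hconst] at hd
      have h0 := hd.unique (hasFDerivAt_const 1 _)
      have := congrArg (fun L => L v) h0
      simp [fderivInnerCLM_apply, real_inner_comm] at this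
      exact this
    have hk : ∀ k, (inner ℝ (F.ι (EuclideanSpace.single k 1))
        (fderiv ℝ (F.normal u) (F.π x) (EuclideanSpace.single k 1)) : ℝ)
        = -pderiv k (fun z => pderiv k u z / jac u z) (F.π x) := by
      intro k
      have hd := (hasFDerivAt_const (F.ι (EuclideanSpace.single k (1 : ℝ))) (F.π x)).inner ℝ
        (hNd (F.π x)).hasFDerivAt
      have hfun : (fun y => (inner ℝ (F.ι (EuclideanSpace.single k (1 : ℝ))) (F.normal u y) : ℝ))
          = fun y => -(pderiv k u y / jac u y) := by
        funext y
        rw [Frame.normal, inner_smul_right, inner_sub_right, F.inner_ι_e, F.ι.inner_map_map,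
          EuclideanSpace.inner_single_left, gradient_apply_eq_pderiv]
        simp; ring
      rw [hfun] at hd
      have := hd.fderiv
      rw [pderiv, ← neg_apply, ← fderiv_fun_neg, this]
      simp [fderivInnerCLM_apply]
    simp only [smul_apply, inner_smul_right, inner_smul_left, hself, hk,
      graphCurv, mul_zero, sub_zero, ← Finset.mul_sum, Finset.sum_neg_distrib]
  rw [meanCurvatureVector, hH, hx, smul_smul]
  rcases hσ with rfl | rfl <;> simp

end IsGraphNear

end Hypersurface

end

/-! ### Partial derivatives and the divergence identity on a graph -/

noncomputable section

namespace Hypersurface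

section Calculus

variable {n : ℕ} {f g u : Base n → ℝ} {y : Base n} (k : Fin n)

theorem pderiv_mul (hf : DifferentiableAt ℝ f y) (hg : DifferentiableAt ℝ g y) :
    pderiv k (fun z => f z * g z) y = f y * pderiv k g y + g y * pderiv k f y := by
  simp [pderiv, fderiv_fun_mul hf hg]

theorem pderiv_sub_const (c : ℝ) : pderiv k (fun z => f z - c) y = pderiv k f y := by
  rw [pderiv, pderiv, fderiv_sub_const]

theorem pderiv_const_mul (c : ℝ) (hf : DifferentiableAt ℝ f y) :
    pderiv k (fun z => c * f z) y = c * pderiv k f y := by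
  simp [pderiv, fderiv_const_mul hf]

theorem pderiv_sum {ι : Type*} (s : Finset ι) {f : ι → Base n → ℝ}
    (hf : ∀ i ∈ s, DifferentiableAt ℝ (f i) y) :
    pderiv k (fun z => ∑ i ∈ s, f i z) y = ∑ i ∈ s, pderiv k (f i) y := by
  simp [pderiv, fderiv_fun_sum hf]

theorem pderiv_congr (h : f =ᶠ[𝓝 y] g) : pderiv k f y = pderiv k g y := by
  rw [pderiv, h.fderiv_eq, pderiv]

theorem pderiv_zero : pderiv k (fun _ : Base n => (0 : ℝ)) y = 0 := by
  simp [pderiv]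

theorem pderiv_comm (hu : ContDiff ℝ 2 u) (j : Fin n) :
    pderiv k (pderiv j u) y = pderiv j (pderiv k u) y := by
  have hd : DifferentiableAt ℝ (fderiv ℝ u) y :=
    ((hu.fderiv_right (m := 1) le_rfl).differentiable one_ne_zero).differentiableAt
  have hs : IsSymmSndFDerivAt ℝ u y := hu.contDiffAt.isSymmSndFDerivAt (by simp)
  have e : ∀ i l : Fin n, pderiv i (pderiv l u) y
      = fderiv ℝ (fderiv ℝ u) y (EuclideanSpace.single i 1) (EuclideanSpace.single l 1) := by
    intro i l
    have := (hd.hasFDerivAt.clm_apply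
      (hasFDerivAt_const (EuclideanSpace.single l (1 : ℝ) : Base n) y)).fderiv
    rw [pderiv, show pderiv l u = fun z => fderiv ℝ u z (EuclideanSpace.single l 1) from rfl, this]
    simp
  rw [e, e, hs.eq]

theorem pderiv_jac (hu : ContDiff ℝ 2 u) :
    pderiv k (jac u) y = (∑ j, pderiv j u y * pderiv k (pderiv j u) y) / jac u y := by
  have hd : ∀ j, DifferentiableAt ℝ (pderiv j u) y := fun j =>
    ((contDiff_pderiv (m := 1) hu j).differentiable one_ne_zero).differentiableAt
  have hj : DifferentiableAt ℝ (jac u) y :=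
    ((contDiff_jac (m := 1) hu).differentiable one_ne_zero).differentiableAt
  -- The derivative of `J` is read off by differentiating `J² = 1 + |∇u|²` in two ways.
  have e1 : pderiv k (fun z => jac u z * jac u z) y = 2 * (jac u y * pderiv k (jac u) y) := by
    rw [pderiv_mul k hj hj]; ring
  have e2 : pderiv k (fun z => jac u z * jac u z) y
      = 2 * ∑ j, pderiv j u y * pderiv k (pderiv j u) y := by
    have : (fun z => jac u z * jac u z) = fun z => (∑ j, pderiv j u z * pderiv j u z) - (-1) := by
      funext z
      rw [← sq, jac_sq]
      simp_rw [sq]; ring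
    rw [this, pderiv_sub_const, pderiv_sum k _ fun j _ => (hd j).fun_mul (hd j), Finset.mul_sum]
    refine Finset.sum_congr rfl fun j _ => ?_
    rw [pderiv_mul k (hd j) (hd j)]; ring
  have hp := jac_pos u y
  rw [eq_div_iff hp.ne']
  linarith

theorem inner_gradient_eq_sum (v : Base n) :
    inner ℝ (∇ u y) v = ∑ k, v k * pderiv k u y := by
  rw [PiLp.inner_apply]
  simp [gradient_apply_eq_pderiv]

theorem integrable_pderiv (hf : ContDiff ℝ 1 f) (hc : HasCompactSupport f) :
    Integrable (pderiv k f) :=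
  (contDiff_pderiv (m := 0) (by simpa using hf) k).continuous.integrable_of_hasCompactSupport
    (hc.fderiv_apply (𝕜 := ℝ) _)

theorem integral_pderiv_eq_zero (hf : ContDiff ℝ 1 f) (hc : HasCompactSupport f) :
    ∫ z, pderiv k f z = 0 := by
  have hi : Integrable fun x => fderiv ℝ f x (EuclideanSpace.single k 1) :=
    integrable_pderiv k hf hc
  have := integral_mul_fderiv_eq_neg_fderiv_mul_of_integrable (𝕜 := ℝ) 
    (μ := (volume : Measure (Base n))) (f := fun _ => (1 : ℝ)) (g := f) (v := EuclideanSpace.single k 1) (by simp)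
    (by simpa using hi) (by simpa using hf.continuous.integrable_of_hasCompactSupport hc)
    (fun x _ => by simp) (fun x _ => (hf.differentiable one_ne_zero).differentiableAt)
  simpa [pderiv] using this

end Calculus

section Divergence

variable {n : ℕ} (F : Frame n) (u ψ : Base n → ℝ) (b : Space n)

/-- Minus the component of `b` along the (non-normalized) normal `e - ∇u`. -/
def normalComp (y : Base n) : ℝ := ∑ j, F.π b j * pderiv j u y - inner ℝ F.e b

/-- The coordinate divergence that represents the tangential divergence of the tangential part of
`ψ b`, multiplied by the Jacobian. -/
def graphDiv (y : Base n) : ℝ :=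
  ∑ k, (F.π b k * pderiv k (fun z => jac u z * ψ z) y
    - pderiv k (fun z => ψ z * normalComp F u b z * (pderiv k u z / jac u z)) y)

variable {u ψ}

theorem contDiff_normalComp (hu : ContDiff ℝ 2 u) : ContDiff ℝ 1 (normalComp F u b) :=
  (ContDiff.sum fun j _ => contDiff_const.mul (contDiff_pderiv (m := 1) hu j)).sub contDiff_const

theorem contDiff_pderiv_div_jac (hu : ContDiff ℝ 2 u) (k : Fin n) :
    ContDiff ℝ 1 fun z => pderiv k u z / jac u z :=
  (contDiff_pderiv (m := 1) hu k).div (contDiff_jac (m := 1) hu) fun z => (jac_pos u z).ne'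

theorem integral_graphDiv (hu : ContDiff ℝ 2 u) (hψ : ContDiff ℝ 1 ψ)
    (hc : HasCompactSupport ψ) : ∫ y, graphDiv F u ψ b y = 0 := by
  have h1 : ContDiff ℝ 1 fun z => jac u z * ψ z := (contDiff_jac (m := 1) hu).mul hψ
  have c1 : HasCompactSupport fun z => jac u z * ψ z := hc.mul_left
  have h2 : ∀ k, ContDiff ℝ 1 fun z => ψ z * normalComp F u b z * (pderiv k u z / jac u z) :=
    fun k => (hψ.mul (contDiff_normalComp F b hu)).mul (contDiff_pderiv_div_jac hu k)
  have c2 : ∀ k, HasCompactSupport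
      fun z => ψ z * normalComp F u b z * (pderiv k u z / jac u z) := fun k => by
    simp_rw [mul_assoc]; exact hc.mul_right
  have hi : ∀ k, Integrable fun y => F.π b k * pderiv k (fun z => jac u z * ψ z) y
      - pderiv k (fun z => ψ z * normalComp F u b z * (pderiv k u z / jac u z)) y := fun k =>
    ((integrable_pderiv k h1 c1).const_mul _).sub (integrable_pderiv k (h2 k) (c2 k))
  unfold graphDiv
  rw [integral_finsetSum _ fun k _ => hi k]
  refine Finset.sum_eq_zero fun k _ => ?_
  rw [integral_sub ((integrable_pderiv k h1 c1).const_mul _) (integrable_pderiv k (h2 k) (c2 k)),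
    integral_const_mul, integral_pderiv_eq_zero k h1 c1, integral_pderiv_eq_zero k (h2 k) (c2 k)]
  simp

/-- This is `div_T (ψ b^T) = b · ∇_T ψ - ψ H (b · N)` times the Jacobian, `b^T` being the tangential
part of `b`. With `c = normalComp F u b`, one has `b · N = -c / J`, and the horizontal part of `J
b^T` is `J π b - c ∇u / J`. After the product rule the derivatives of `J` and `c` cancel, and those
of `∇u / J` assemble into `graphCurv`. -/
theorem graphDiv_eq (hu : ContDiff ℝ 2 u) {y : Base n} (hψ : DifferentiableAt ℝ ψ y) :
    graphDiv F u ψ b y = jac u y * inner ℝ b (tproj (F.normal u y) (F.ι (∇ ψ y))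
      - ψ y • graphCurv u y • F.normal u y) := by
  have hw := (jac_pos u y).ne'
  have hN : inner ℝ b (F.normal u y) = -(normalComp F u b y / jac u y) := by
    rw [Frame.normal, inner_smul_right, inner_sub_right, real_inner_comm (F.ι _) b, ← F.inner_π,
      normalComp, real_inner_comm F.e b, inner_gradient_eq_sum]
    field_simp
    ring
  have hb : inner ℝ b (F.ι (∇ ψ y)) = ∑ k, F.π b k * pderiv k ψ y := by
    rw [real_inner_comm, ← F.inner_π, inner_gradient_eq_sum]
  have hg : inner ℝ (F.ι (∇ ψ y)) (F.normal u y)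
      = -∑ k, pderiv k ψ y * (pderiv k u y / jac u y) := by
    rw [Frame.normal, inner_smul_right, inner_sub_right, F.inner_ι_e, F.ι.inner_map_map,
      inner_gradient_eq_sum]
    simp only [gradient_apply_eq_pderiv, zero_sub, mul_neg, Finset.mul_sum]
    congr 1
    refine Finset.sum_congr rfl fun k _ => ?_
    field_simp
  have hjd : DifferentiableAt ℝ (jac u) y :=
    ((contDiff_jac (m := 1) hu).differentiable one_ne_zero).differentiableAt
  have hcd : DifferentiableAt ℝ (normalComp F u b) y :=
    ((contDiff_normalComp F b hu).differentiable one_ne_zero).differentiableAt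
  have hqd : ∀ k, DifferentiableAt ℝ (fun z => pderiv k u z / jac u z) y := fun k =>
    ((contDiff_pderiv_div_jac hu k).differentiable one_ne_zero).differentiableAt
  have hud : ∀ k, DifferentiableAt ℝ (pderiv k u) y := fun k =>
    ((contDiff_pderiv (m := 1) hu k).differentiable one_ne_zero).differentiableAt
  have hck : ∀ k, pderiv k (normalComp F u b) y = ∑ j, F.π b j * pderiv k (pderiv j u) y := by
    intro k
    unfold normalComp
    rw [pderiv_sub_const, pderiv_sum k _ fun j _ => (hud j).const_mul _]
    exact Finset.sum_congr rfl fun j _ => pderiv_const_mul k _ (hud j)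
  have hterm : ∀ k, F.π b k * pderiv k (fun z => jac u z * ψ z) y
      - pderiv k (fun z => ψ z * normalComp F u b z * (pderiv k u z / jac u z)) y
      = ψ y * (F.π b k * pderiv k (jac u) y)
        - ψ y * (pderiv k (normalComp F u b) y * (pderiv k u y / jac u y))
        + jac u y * (F.π b k * pderiv k ψ y)
        - normalComp F u b y * (pderiv k ψ y * (pderiv k u y / jac u y))
        - ψ y * normalComp F u b y * pderiv k (fun z => pderiv k u z / jac u z) y := by
    intro k
    rw [pderiv_mul k hjd hψ, pderiv_mul k (hψ.fun_mul hcd) (hqd k), pderiv_mul k hψ hcd]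
    ring
  -- Both sides equal the Hessian of `u` evaluated on `π b` and `∇u`, divided by `J`; symmetry of
  -- second derivatives, hence `u ∈ C²`, is used here.
  have hsymm : ∑ k, F.π b k * pderiv k (jac u) y
      = ∑ k, pderiv k (normalComp F u b) y * (pderiv k u y / jac u y) := by
    simp_rw [pderiv_jac _ hu, hck, Finset.sum_mul, Finset.sum_div, Finset.mul_sum]
    rw [Finset.sum_comm]
    refine Finset.sum_congr rfl fun k _ => Finset.sum_congr rfl fun j _ => ?_
    rw [pderiv_comm j hu k]
    ring
  rw [graphDiv, Finset.sum_congr rfl fun k _ => hterm k]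
  simp only [Finset.sum_sub_distrib, Finset.sum_add_distrib, ← Finset.mul_sum]
  rw [hsymm, tproj, inner_sub_right, inner_sub_right, inner_smul_right, inner_smul_right,
    inner_smul_right, hN, hb, hg, graphCurv]
  field_simp
  ring

theorem graphDiv_eq_zero {y : Base n} (h : ψ =ᶠ[𝓝 y] fun _ => 0) : graphDiv F u ψ b y = 0 := by
  refine Finset.sum_eq_zero fun k _ => ?_
  rw [pderiv_congr k (f := fun z => jac u z * ψ z) (g := fun _ => 0)
      (h.mono fun z hz => by simp [hz]),
    pderiv_congr k (f := fun z => ψ z * normalComp F u b z * (pderiv k u z / jac u z))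
      (g := fun _ => 0) (h.mono fun z hz => by simp [hz]), pderiv_zero]
  simp

end Divergence

end Hypersurface

end

/-! ### Measurability, continuity and local integrability on a hypersurface -/

noncomputable section

namespace Hypersurface

variable {n : ℕ} {M : Set (Space n)}

/-- `M` is locally closed, as it coincides near each of its points with a closed graph. -/
theorem IsSmoothHypersurface.measurableSet (hM : IsSmoothHypersurface M) : MeasurableSet M := by
  have h : IsLocallyClosed M := by
    refine ((isLocallyClosed_tfae M).out 0 2).2 fun x hx => ?_
    obtain ⟨F, u, hu, hev⟩ := hM.exists_graph hx
    refine ⟨_, hev, ?_⟩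
    have hcl : IsClosed (Set.range (F.graphMap u)) :=
      (F.isClosedEmbedding_graphMap hu.continuous).isClosed_range
    convert hcl.preimage continuous_subtype_val using 1
    ext ⟨z, hz⟩
    exact hz
  obtain ⟨U, Z, hU, hZ, rfl⟩ := h
  exact hU.measurableSet.inter hZ.measurableSet

theorem eventually_mem_of_compact_compl {K : Set (Space n)} (hK : IsCompact K) {x : Space n}
    (hx : x ∉ K) : ∀ᶠ y in 𝓝 x, y ∉ K :=
  hK.isClosed.isOpen_compl.mem_nhds hx

section Continuity

variable (hM : IsSmoothHypersurface M)

include hM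

/-- The chosen sign of `unitNormal` may jump, so continuity can be expected only of expressions that
are even in the normal. In a graph patch these have continuous formulas. -/
theorem continuousOn_meanCurvatureVector : ContinuousOn (meanCurvatureVector M) M := by
  intro x hx
  obtain ⟨F, u, h⟩ := hM.exists_isGraphNear hx
  have hcurv : Continuous (graphCurv u) := by
    refine (continuous_finsetSum _ fun k _ => ?_).neg
    exact (contDiff_pderiv (m := 0) (contDiff_pderiv_div_jac h.contDiff k) k).continuous
  have hc : ContinuousAt (fun y => graphCurv u (F.π y) • F.normal u (F.π y)) x :=
    (hcurv.comp F.π.continuous).continuousAt.smul h.continuousAt_normal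
  refine hc.continuousWithinAt.congr_of_eventuallyEq ?_ (h.meanCurvatureVector_eq hM)
  filter_upwards [h.eventually_isGraphNear] with y hy using hy.meanCurvatureVector_eq hM

theorem continuousOn_tangentialGradient {φ : Space n → ℝ}
    (hφ : ∀ x ∈ M, ∃ ψ, IsC1ExtensionNear M φ x ψ) : ContinuousOn (tangentialGradient M φ) M := by
  intro x hx
  obtain ⟨F, u, h⟩ := hM.exists_isGraphNear hx
  obtain ⟨ψ, hψ⟩ := hφ x hx
  have hc : ContinuousAt (fun y => tproj (F.normal u (F.π y)) (∇ ψ y)) x := by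
    have hg : ContinuousAt (∇ ψ) x :=
      (contDiffAt_gradient (m := 0) (by simpa using hψ.1)).continuousAt
    have hi : ContinuousAt (fun y => (inner ℝ (∇ ψ y) (F.normal u (F.π y)) : ℝ)) x :=
      hg.inner h.continuousAt_normal
    exact hg.sub (hi.smul h.continuousAt_normal)
  have hev : ∀ᶠ y in 𝓝[M] x,
      tangentialGradient M φ y = tproj (F.normal u (F.π y)) (∇ ψ y) := by
    filter_upwards [h.eventually_isGraphNear, mem_nhdsWithin_of_mem_nhds (hψ.1.eventually (by simp)),
      eventually_eventually_nhdsWithin.2 hψ.2] with y h1 h2 h3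
    rw [h1.tangentialGradient_eq hM ⟨h2, h3⟩, h1.ambientTangentialGradient_eq hM]
  exact hc.continuousWithinAt.congr_of_eventuallyEq hev (hev.self_of_nhdsWithin hx)

theorem continuousOn_inner_unitNormal_sq :
    ContinuousOn (fun x => (inner ℝ x (unitNormal M x) : ℝ) ^ 2) M := by
  intro x hx
  obtain ⟨F, u, h⟩ := hM.exists_isGraphNear hx
  have hc : ContinuousAt (fun y => (inner ℝ y (F.normal u (F.π y)) : ℝ) ^ 2) x :=
    (continuousAt_id.inner h.continuousAt_normal).pow 2
  have hev : ∀ᶠ y in 𝓝[M] x, (inner ℝ y (unitNormal M y) : ℝ) ^ 2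
      = (inner ℝ y (F.normal u (F.π y)) : ℝ) ^ 2 := by
    filter_upwards [h.eventually_isGraphNear] with y hy
    rcases hy.unitNormal_eq_or hM with h' | h'
    · rw [h']
    · rw [h']; simp
  exact hc.continuousWithinAt.congr_of_eventuallyEq hev (hev.self_of_nhdsWithin hx)

theorem norm_unitNormal {x : Space n} (hx : x ∈ M) : ‖unitNormal M x‖ = 1 :=
  ((hM.isUnitNormalFieldNear_localNormal hx).2.self_of_nhdsWithin hx).1

theorem tangentialGradient_eq_zero {φ : Space n → ℝ} {K : Set (Space n)} (hK : IsCompact K)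
    (hφ : ∀ x ∈ M, x ∉ K → φ x = 0) {x : Space n} (hx : x ∈ M) (hxK : x ∉ K) :
    tangentialGradient M φ x = 0 := by
  obtain ⟨F, u, h⟩ := hM.exists_isGraphNear hx
  rw [h.tangentialGradient_eq hM (ψ := fun _ => 0) ⟨contDiffAt_const, ?_⟩,
    h.ambientTangentialGradient_eq hM]
  · simp [tproj, gradient_fun_const]
  · filter_upwards [self_mem_nhdsWithin,
      mem_nhdsWithin_of_mem_nhds (eventually_mem_of_compact_compl hK hxK)] with y h1 h2
    rw [hφ y h1 h2]

end Continuity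

theorem IsC1c.continuousOn {φ : Space n → ℝ} (hφ : ∀ x ∈ M, ∃ ψ, IsC1ExtensionNear M φ x ψ) :
    ContinuousOn φ M := by
  intro x hx
  obtain ⟨ψ, hψ⟩ := hφ x hx
  exact hψ.1.continuousAt.continuousWithinAt.congr_of_eventuallyEq
    (hψ.2.mono fun y hy => hy.symm) (hψ.2.self_of_nhdsWithin hx).symm

theorem setIntegral_graph (F : Frame n) {u : Base n → ℝ} (hu : ContDiff ℝ 1 u)
    (f : Space n → ℝ) :
    ∫ x in Set.range (F.graphMap u), f x ∂μHE[n] = ∫ y, jac u y * f (F.graphMap u y) := by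
  have hj : Continuous (jac u) := (contDiff_jac (m := 0) (by simpa using hu)).continuous
  rw [hausdorff_restrict_graph F hu,
    (F.isClosedEmbedding_graphMap hu.continuous).measurableEmbedding.integral_map,
    integral_withDensity_eq_integral_toReal_smul (by fun_prop) (by simp)]
  refine integral_congr_ae (Eventually.of_forall fun y => ?_)
  simp [ENNReal.toReal_ofReal (jac_pos u y).le]

/-- Since `|y| ≤ |graphMap u y|` and the Jacobian is bounded on balls, this reduces to the
integrability of `|y|^(-b)` near the origin of `ℝ^n`. -/
theorem integrableOn_graph_ball (hn : 0 < n) (F : Frame n) {u : Base n → ℝ}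
    (hu : ContDiff ℝ 1 u) {b : ℝ} (hb0 : 0 ≤ b) (hb : b < n) (R : ℝ) :
    IntegrableOn (fun x => ‖x‖ ^ (-b)) (Set.range (F.graphMap u) ∩ Metric.ball 0 R) μHE[n] := by
  have hj : Continuous (jac u) := (contDiff_jac (m := 0) (by simpa using hu)).continuous
  have hemb := (F.isClosedEmbedding_graphMap hu.continuous).measurableEmbedding
  rw [Set.inter_comm, IntegrableOn, ← Measure.restrict_restrict measurableSet_ball,
    hausdorff_restrict_graph F hu, ← IntegrableOn, hemb.integrableOn_map_iff]
  refine IntegrableOn.mono_set (t := Metric.ball 0 R) ?_ ?_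
  swap
  · intro y hy
    simp only [Set.mem_preimage, mem_ball_zero_iff] at hy ⊢
    exact (F.norm_le_norm_graphMap y).trans_lt hy
  rw [IntegrableOn, restrict_withDensity measurableSet_ball,
    integrable_withDensity_iff_integrable_smul' (by fun_prop) (by simp)]
  obtain ⟨C, hC⟩ := (isCompact_closedBall (0 : Base n) R).exists_bound_of_continuousOn
    hj.continuousOn
  refine integrableOn_ball_of_norm_le_rpow (C := C) (α := b)
    (by rw [finrank_euclideanSpace_fin]; exact hn)
    (by simpa using hb) ?_ ?_
  -- The pointwise bound can fail at `y = 0`, where `‖y‖ ^ (-b)` takes the value `0` if `b ≠ 0`;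
  -- this point is null because `0 < n`.
  · have hnull : ∀ᵐ y : Base n ∂volume.restrict (Metric.ball 0 R), y ≠ 0 := by
      have : Nontrivial (Base n) := Module.nontrivial_of_finrank_pos (R := ℝ) (by simpa using hn)
      exact ae_restrict_of_ae (Measure.ae_ne volume 0)
    filter_upwards [hnull, ae_restrict_mem measurableSet_ball] with y hy0 hy
    have h1 := hC y (Metric.ball_subset_closedBall hy)
    have hy0' : 0 < ‖y‖ := norm_pos_iff.2 hy0
    have h2 : ‖F.graphMap u y‖ ^ (-b) ≤ ‖y‖ ^ (-b) :=
      Real.rpow_le_rpow_of_nonpos hy0' (F.norm_le_norm_graphMap y) (by linarith)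
    rw [ENNReal.toReal_ofReal (jac_pos u y).le, smul_eq_mul, norm_mul]
    have h3 : 0 ≤ ‖F.graphMap u y‖ ^ (-b) := by positivity
    rw [Function.comp_apply, Real.norm_of_nonneg h3]
    exact mul_le_mul h1 h2 h3 ((norm_nonneg _).trans h1)
  · have hg : Measurable (F.graphMap u) := hemb.measurable
    have : Measurable fun y => (ENNReal.ofReal (jac u y)).toReal •
      ((fun x : Space n => ‖x‖ ^ (-b)) ∘ F.graphMap u) y := by
      have h1 : Measurable fun y => (ENNReal.ofReal (jac u y)).toReal := by fun_prop
      exact h1.smul ((hg.norm).pow_const _)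
    exact this.aestronglyMeasurable

theorem integrableOn_mul_rpow_of_nonneg (hM : IsSmoothHypersurface M) (hn : 0 < n)
    {f : Space n → ℝ} (hf : ContinuousOn f M) {K : Set (Space n)} (hK : IsCompact K)
    (hKM : K ⊆ M) {b : ℝ} (hb0 : 0 ≤ b) (hb : b < n) :
    IntegrableOn (fun x => f x * ‖x‖ ^ (-b)) K μHE[n] := by
  refine LocallyIntegrableOn.integrableOn_isCompact (fun x hx => ?_) hK
  obtain ⟨F, u, h⟩ := hM.exists_isGraphNear (hKM hx)
  obtain ⟨C, hC⟩ := hK.exists_bound_of_continuousOn (hf.mono hKM)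
  refine ⟨K ∩ ({z | z ∈ M ↔ z ∈ Set.range (F.graphMap u)} ∩ Metric.ball 0 (‖x‖ + 1)),
    inter_mem self_mem_nhdsWithin (mem_nhdsWithin_of_mem_nhds
      (inter_mem h.eventually (Metric.isOpen_ball.mem_nhds (by simp)))), ?_⟩
  set S := Set.range (F.graphMap u) ∩ Metric.ball 0 (‖x‖ + 1)
  have hSm : MeasurableSet S :=
    (F.isClosedEmbedding_graphMap h.contDiff.continuous).isClosed_range.measurableSet.inter
      measurableSet_ball
  refine IntegrableOn.mono_set (t := K ∩ S) ?_
    (fun z hz => ⟨hz.1, hz.2.1.1 (hKM hz.1), hz.2.2⟩)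
  have hi : IntegrableOn (fun z : Space n => C * ‖z‖ ^ (-b)) (K ∩ S) μHE[n] :=
    ((integrableOn_graph_ball hn F (h.contDiff.of_le one_le_two) hb0 hb _).mono_set
      Set.inter_subset_right).const_mul C
  have hm : MeasurableSet (K ∩ S) := hK.measurableSet.inter hSm
  refine Integrable.mono' hi ?_ ?_
  · refine ((hf.mono (Set.inter_subset_left.trans hKM)).aestronglyMeasurable hm).mul ?_
    exact (measurable_norm.pow_const _).aestronglyMeasurable
  · filter_upwards [ae_restrict_mem hm] with z hz
    have h3 : 0 ≤ ‖z‖ ^ (-b) := by positivity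
    rw [norm_mul, Real.norm_of_nonneg h3]
    exact mul_le_mul_of_nonneg_right (hC z hz.1) h3

/-- Local integrability of `‖x‖ ^ (-b)` on a hypersurface for `b < n`. -/
theorem integrableOn_mul_rpow (hM : IsSmoothHypersurface M) (hn : 0 < n)
    {f : Space n → ℝ} (hf : ContinuousOn f M) {K : Set (Space n)} (hK : IsCompact K)
    (hKM : K ⊆ M) {b : ℝ} (hb : b < n) :
    IntegrableOn (fun x => f x * ‖x‖ ^ (-b)) K μHE[n] := by
  rcases le_or_gt 0 b with h0 | h0
  · exact integrableOn_mul_rpow_of_nonneg hM hn hf hK hKM h0 hb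
  -- For `b < 0` the weight is continuous and is absorbed into `f`.
  · have hc : ContinuousOn (fun x => f x * ‖x‖ ^ (-b)) M :=
      hf.mul ((continuous_norm.rpow_const fun _ => Or.inr (by linarith)).continuousOn)
    simpa using integrableOn_mul_rpow_of_nonneg hM hn hc hK hKM le_rfl (by exact_mod_cast hn)

theorem integrableOn_of_continuousOn (hM : IsSmoothHypersurface M) (hn : 0 < n)
    {f : Space n → ℝ} (hf : ContinuousOn f M) {K : Set (Space n)} (hK : IsCompact K)
    (hKM : K ⊆ M) : IntegrableOn f K μHE[n] := by
  simpa using integrableOn_mul_rpow hM hn hf hK hKM (b := 0) (by exact_mod_cast hn)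

/-- Makes the values assigned at the origin by division and real powers immaterial. For `n = 0` the
origin would be an atom. -/
theorem ae_ne_zero (hn : 0 < n) (s : Set (Space n)) : ∀ᵐ x ∂(μHE[n]).restrict s, x ≠ 0 := by
  refine ae_restrict_of_ae ?_
  have := Measure.nullSingletonClass_hausdorff (Space n) (d := n) (by exact_mod_cast hn)
  have h0 : (μHE[n] : Measure (Space n)) {0} = 0 := by
    rw [Measure.euclideanHausdorffMeasure_def, Measure.smul_apply, measure_singleton]; simp
  exact compl_mem_ae_iff.2 h0

/-- Integrals over `M` of functions that vanish outside of a compact subset. -/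
theorem integral_vol_eq (hM : IsSmoothHypersurface M) {K : Set (Space n)} (hKM : K ⊆ M)
    {f : Space n → ℝ} (hf : ∀ x ∈ M, x ∉ K → f x = 0) :
    ∫ x, f x ∂(vol M) = ∫ x in K, f x ∂μHE[n] :=
  setIntegral_eq_of_subset_of_forall_sdiff_eq_zero hM.measurableSet hKM
    fun x hx => hf x hx.1 hx.2

theorem integrable_vol_iff (hM : IsSmoothHypersurface M) {K : Set (Space n)}
    (hKM : K ⊆ M) {f : Space n → ℝ} (hf : ∀ x ∈ M, x ∉ K → f x = 0) :
    Integrable f (vol M) ↔ IntegrableOn f K μHE[n] := by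
  constructor
  · intro h
    exact IntegrableOn.mono_set (t := M) h hKM
  · intro h
    exact IntegrableOn.of_forall_sdiff_eq_zero h hM.measurableSet fun x hx => hf x hx.1 hx.2

end Hypersurface

end

/-! ### The divergence theorem on a hypersurface -/

noncomputable section

namespace Hypersurface

open scoped Manifold

variable {n : ℕ} {M : Set (Space n)}

/-- The vector `∇_T φ - φ 𝓗`, whose integral over `M` vanishes. -/
def defect (M : Set (Space n)) (φ : Space n → ℝ) (x : Space n) : Space n :=
  tangentialGradient M φ x - φ x • meanCurvatureVector M x

theorem defect_eq_zero (hM : IsSmoothHypersurface M) {φ : Space n → ℝ} {K : Set (Space n)}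
    (hK : IsCompact K) (hφ : ∀ x ∈ M, x ∉ K → φ x = 0) {x : Space n} (hx : x ∈ M) (hxK : x ∉ K) :
    defect M φ x = 0 := by
  rw [defect, tangentialGradient_eq_zero hM hK hφ hx hxK, hφ x hx hxK]; simp

theorem continuousOn_inner_defect (hM : IsSmoothHypersurface M) {φ : Space n → ℝ}
    (hφ : ∀ x ∈ M, ∃ ψ, IsC1ExtensionNear M φ x ψ) (b : Space n) :
    ContinuousOn (fun x => (inner ℝ b (defect M φ x) : ℝ)) M :=
  continuousOn_const.inner ((continuousOn_tangentialGradient hM hφ).sub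
    ((IsC1c.continuousOn hφ).smul (continuousOn_meanCurvatureVector hM)))

/-- The divergence theorem for functions supported in a graph patch. -/
theorem integral_inner_defect_of_graph (hM : IsSmoothHypersurface M) {F : Frame n}
    {u : Base n → ℝ} (hu : ContDiff ℝ 2 u) {U : Set (Space n)} (hU : IsOpen U)
    (hMU : ∀ z ∈ U, z ∈ M ↔ z ∈ Set.range (F.graphMap u)) {φ : Space n → ℝ}
    (hφ : ∀ x ∈ M, ∃ ψ, IsC1ExtensionNear M φ x ψ) {K : Set (Space n)} (hK : IsCompact K)
    (hKM : K ⊆ M) (hKU : K ⊆ U) (hφK : ∀ x ∈ M, x ∉ K → φ x = 0) (b : Space n) :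
    ∫ x, inner ℝ b (defect M φ x) ∂(vol M) = 0 := by
  classical
  set g := F.graphMap u
  have hgc : Continuous g := (F.isClosedEmbedding_graphMap hu.continuous).continuous
  have hg1 : ContDiff ℝ 1 g := F.contDiff_graphMap (hu.of_le one_le_two)
  have hKr : K ⊆ Set.range g := fun z hz => (hMU z (hKU hz)).1 (hKM hz)
  have hgr : ∀ y, g y ∈ U → IsGraphNear M F u (g y) := fun y hy =>
    ⟨(hMU _ hy).2 ⟨y, rfl⟩, hu, Filter.mem_of_superset (hU.mem_nhds hy) hMU⟩
  -- The pullback is cut off outside `K` because `φ` is arbitrary off `M`, and the graph may leave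
  -- `M` outside `U`. The cutoff changes nothing on `M`, where `φ` already vanishes off `K`.
  set ψ : Base n → ℝ := fun y => K.indicator φ (g y) with hψdef
  have hψU : ∀ y, g y ∈ U → ∀ᶠ z in 𝓝 y, ψ z = φ (g z) := by
    intro y hy
    filter_upwards [hgc.continuousAt.eventually (hU.mem_nhds hy)] with z hz
    by_cases hzK : g z ∈ K
    · rw [hψdef]; exact Set.indicator_of_mem hzK _
    · rw [hψdef]; simp only
      rw [Set.indicator_of_notMem hzK, hφK _ (hgr z hz).mem hzK]
  have hψK : ∀ y, g y ∉ K → ψ =ᶠ[𝓝 y] fun _ => 0 := by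
    intro y hy
    filter_upwards [hgc.continuousAt.eventually (eventually_mem_of_compact_compl hK hy)] with z hz
    exact Set.indicator_of_notMem hz _
  have hψ1 : ContDiff ℝ 1 ψ := by
    refine contDiff_iff_contDiffAt.2 fun y => ?_
    by_cases hy : g y ∈ U
    · obtain ⟨ψ₀, h1, h2⟩ := hφ _ (hgr y hy).mem
      refine (h1.comp y hg1.contDiffAt).congr_of_eventuallyEq ?_
      have hgM : Tendsto g (𝓝 y) (𝓝[M] (g y)) := tendsto_nhdsWithin_iff.2
        ⟨hgc.continuousAt, (hgc.continuousAt.eventually (hU.mem_nhds hy)).mono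
          fun z hz => (hgr z hz).mem⟩
      filter_upwards [hψU y hy, hgM.eventually h2] with z h3 h4
      rw [h3, Function.comp_apply, h4]
    · exact contDiffAt_const.congr_of_eventuallyEq (hψK y fun h => hy (hKU h))
  have hψc : HasCompactSupport ψ := by
    refine HasCompactSupport.intro (hK.image F.π.continuous) fun y hy => ?_
    refine Set.indicator_of_notMem (fun h => hy ⟨g y, h, F.π_graphMap y⟩) _
  -- The function `ψ ∘ π` is a `C¹` extension of `φ` near points of `K`, so the intrinsic quantities
  -- can be computed from `ψ`.
  have hpt : ∀ y, jac u y * K.indicator (fun x => (inner ℝ b (defect M φ x) : ℝ)) (g y)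
      = graphDiv F u ψ b y := by
    intro y
    by_cases hy : g y ∈ K
    · have hyU := hKU hy
      have h := hgr y hyU
      have hπ : F.π (g y) = y := F.π_graphMap y
      have hψd : DifferentiableAt ℝ ψ (F.π (g y)) :=
        (hψ1.differentiable one_ne_zero).differentiableAt
      have hext : IsC1ExtensionNear M φ (g y) fun z => ψ (F.π z) := by
        refine ⟨(hψ1.comp F.π.contDiff).contDiffAt, ?_⟩
        have hc : Tendsto F.π (𝓝[M] (g y)) (𝓝 y) := by
          have := F.π.continuous.continuousAt (x := g y)
          rw [ContinuousAt, hπ] at this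
          exact this.mono_left nhdsWithin_le_nhds
        filter_upwards [hc.eventually (hψU y hyU), h.eventually_isGraphNear] with z h1 h2
        rw [h1]
        exact congrArg φ h2.graphMap_π
      rw [Set.indicator_of_mem hy, graphDiv_eq F b hu (by rwa [hπ] at hψd), defect,
        h.tangentialGradient_eq hM hext, h.ambientTangentialGradient_eq hM,
        IsGraphNear.gradient_comp_π hψd, h.meanCurvatureVector_eq hM, hπ,
        (hψU y hyU).self_of_nhds]
    · rw [Set.indicator_of_notMem hy, mul_zero, graphDiv_eq_zero F b (hψK y hy)]
  rw [integral_vol_eq hM hKM (K := K) fun x hx hxK => by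
    rw [defect_eq_zero hM hK hφK hx hxK, inner_zero_right]]
  rw [← Set.inter_eq_right.2 hKr, ← setIntegral_indicator hK.measurableSet,
    setIntegral_graph F (hu.of_le one_le_two)]
  simp_rw [show F.graphMap u = g from rfl, hpt]
  exact integral_graphDiv F b hu hψ1 hψc

/-- The divergence theorem on a hypersurface: the integral of `∇_T φ - φ 𝓗` vanishes. -/
theorem integral_inner_defect (hM : IsSmoothHypersurface M) (hn : 0 < n) {φ : Space n → ℝ}
    (hφ : ∀ x ∈ M, ∃ ψ, IsC1ExtensionNear M φ x ψ) {K : Set (Space n)} (hK : IsCompact K)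
    (hKM : K ⊆ M) (hφK : ∀ x ∈ M, x ∉ K → φ x = 0) (b : Space n) :
    ∫ x, inner ℝ b (defect M φ x) ∂(vol M) = 0 := by
  have hloc : ∀ x : K, ∃ (F : Frame n) (u : Base n → ℝ) (U : Set (Space n)), ContDiff ℝ 2 u ∧
      IsOpen U ∧ x.1 ∈ U ∧ ∀ z ∈ U, z ∈ M ↔ z ∈ Set.range (F.graphMap u) := by
    intro x
    obtain ⟨F, u, hu, hev⟩ := hM.exists_graph (hKM x.2)
    obtain ⟨U, h1, h2, h3⟩ := eventually_nhds_iff.1 hev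
    exact ⟨F, u, U, hu, h2, h3, h1⟩
  choose F u U hu hU hxU hMU using hloc
  obtain ⟨t, ht⟩ := hK.elim_finite_subcover U hU fun x hx => Set.mem_iUnion.2 ⟨⟨x, hx⟩, hxU _⟩
  -- The functions sum to `1` on `K` only; this suffices because `φ` vanishes on the rest of `M`.
  obtain ⟨ρ, hρ⟩ := SmoothPartitionOfUnity.exists_isSubordinate 𝓘(ℝ, Space n) hK.isClosed
    (fun i : t => U i) (fun i => hU i) (by simpa [Set.iUnion_subtype] using ht)
  have hρs : ∀ i, ContDiff ℝ ∞ (ρ i) := fun i => (ρ i).contMDiff.contDiff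
  have hsum : ∀ x ∈ K, ∑ i, ρ i x = 1 := by
    intro x hx
    rw [← finsum_eq_sum_of_fintype]
    exact ρ.sum_eq_one hx
  set φi : t → Space n → ℝ := fun i x => ρ i x * φ x
  have hφi : ∀ i, ∀ x ∈ M, ∃ ψ, IsC1ExtensionNear M (φi i) x ψ := by
    intro i x hx
    obtain ⟨ψ, h1, h2⟩ := hφ x hx
    exact ⟨fun y => ρ i y * ψ y, (((hρs i).of_le (by simp)).contDiffAt).mul h1,
      h2.mono fun y hy => by simp only [φi, hy]⟩
  have hKi : ∀ i, IsCompact (K ∩ tsupport (ρ i)) := fun i => hK.inter_right (isClosed_tsupport _)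
  have hφiK : ∀ i, ∀ x ∈ M, x ∉ K ∩ tsupport (ρ i) → φi i x = 0 := by
    intro i x hx hxK
    by_cases h : x ∈ K
    · have : ρ i x = 0 := image_eq_zero_of_notMem_tsupport fun h' => hxK ⟨h, h'⟩
      simp [φi, this]
    · simp [φi, hφK x hx h]
  have hzero : ∀ i, ∫ x, inner ℝ b (defect M (φi i) x) ∂(vol M) = 0 := fun i =>
    integral_inner_defect_of_graph hM (hu i) (hU i) (hMU i) (hφi i) (hKi i)
      (Set.inter_subset_left.trans hKM) (Set.inter_subset_right.trans (hρ i)) (hφiK i) b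
  have hint : ∀ i, Integrable (fun x => (inner ℝ b (defect M (φi i) x) : ℝ)) (vol M) := fun i =>
    (integrable_vol_iff hM (Set.inter_subset_left.trans hKM) fun x hx hxK => by
      rw [defect_eq_zero hM (hKi i) (hφiK i) hx hxK, inner_zero_right]).2
    (integrableOn_of_continuousOn hM hn (continuousOn_inner_defect hM (hφi i) b) (hKi i)
      (Set.inter_subset_left.trans hKM))
  -- The defect is linear in `φ`. For the gradient this is seen through compatible extensions `ρ i *
  -- ψ`, all built from one extension `ψ` of `φ`.
  have hadd : ∀ x ∈ M, defect M φ x = ∑ i, defect M (φi i) x := by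
    intro x hx
    obtain ⟨G, v, h⟩ := hM.exists_isGraphNear hx
    obtain ⟨ψ, h1, h2⟩ := hφ x hx
    have hφsum : ∀ y ∈ M, φ y = ∑ i, φi i y := by
      intro y hy
      simp only [φi]
      rw [← Finset.sum_mul]
      by_cases hyK : y ∈ K
      · rw [hsum y hyK, one_mul]
      · rw [hφK y hy hyK, mul_zero]
    have hd : ∀ i, ContDiffAt ℝ 1 (fun y => ρ i y * ψ y) x := fun i =>
      (((hρs i).of_le (by simp)).contDiffAt).mul h1
    have hexti : ∀ i, IsC1ExtensionNear M (φi i) x fun y => ρ i y * ψ y := fun i =>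
      ⟨hd i, h2.mono fun y hy => by simp only [φi, hy]⟩
    have hext : IsC1ExtensionNear M φ x fun y => ∑ i, ρ i y * ψ y := by
      refine ⟨ContDiffAt.sum fun i _ => hd i, ?_⟩
      filter_upwards [h2, self_mem_nhdsWithin] with y hy hyM
      rw [hφsum y hyM]
      exact Finset.sum_congr rfl fun i _ => by simp only [φi, hy]
    have hgrad : ∇ (fun y => ∑ i, ρ i y * ψ y) x = ∑ i, ∇ (fun y => ρ i y * ψ y) x := by
      simp only [gradient]
      rw [fderiv_fun_sum fun i _ => (hd i).differentiableAt one_ne_zero, map_sum]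
    have htsum : ∀ (ν : Space n) (w : t → Space n), tproj ν (∑ i, w i) = ∑ i, tproj ν (w i) := by
      intro ν w
      simp only [tproj, sum_inner, Finset.sum_smul, Finset.sum_sub_distrib]
    simp only [defect, Finset.sum_sub_distrib, ← Finset.sum_smul]
    rw [← hφsum x hx, h.tangentialGradient_eq hM hext, h.ambientTangentialGradient_eq hM, hgrad,
      htsum]
    congr 1
    refine Finset.sum_congr rfl fun i _ => ?_
    rw [h.tangentialGradient_eq hM (hexti i), h.ambientTangentialGradient_eq hM]
  have : ∫ x, inner ℝ b (defect M φ x) ∂(vol M)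
      = ∫ x, ∑ i, (inner ℝ b (defect M (φi i) x) : ℝ) ∂(vol M) := by
    refine setIntegral_congr_fun hM.measurableSet fun x hx => ?_
    simp only [hadd x hx, inner_sum]
  rw [this, integral_finsetSum _ fun i _ => hint i]
  exact Finset.sum_eq_zero fun i _ => hzero i

end Hypersurface

end

/-! ### Hölder's inequality, regularized powers and the radial vector field -/

noncomputable section

namespace Hypersurface

/-- Hölder's inequality with exponents that may vanish. -/
theorem integral_rpow_mul_rpow_le {α : Type*} [MeasurableSpace α] {μ : Measure α} {f g : α → ℝ}
    (hf : Integrable f μ) (hg : Integrable g μ) (hf0 : ∀ x, 0 ≤ f x) (hg0 : ∀ x, 0 ≤ g x)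
    {s t : ℝ} (hs : 0 ≤ s) (ht : 0 ≤ t) (hst : s + t = 1) :
    Integrable (fun x => f x ^ s * g x ^ t) μ ∧
      ∫ x, f x ^ s * g x ^ t ∂μ ≤ (∫ x, f x ∂μ) ^ s * (∫ x, g x ∂μ) ^ t := by
  have hn : ∀ x, 0 ≤ f x ^ s * g x ^ t := fun x =>
    mul_nonneg (Real.rpow_nonneg (hf0 x) _) (Real.rpow_nonneg (hg0 x) _)
  have hi : Integrable (fun x => f x ^ s * g x ^ t) μ := by
    -- Weighted arithmetic–geometric mean: `f^s g^t ≤ s f + t g`.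
    refine Integrable.mono' ((hf.const_mul s).add (hg.const_mul t)) ?_ ?_
    · exact ((hf.1.aemeasurable.pow_const s).mul (hg.1.aemeasurable.pow_const t)).aestronglyMeasurable
    · refine Eventually.of_forall fun x => ?_
      rw [Real.norm_of_nonneg (hn x)]
      exact Real.geom_mean_le_arith_mean2_weighted hs ht (hf0 x) (hg0 x) hst
  refine ⟨hi, ?_⟩
  have hF : 0 ≤ ∫ x, f x ∂μ := integral_nonneg hf0
  have hG : 0 ≤ ∫ x, g x ∂μ := integral_nonneg hg0
  rw [← ENNReal.ofReal_le_ofReal_iff (by positivity), ENNReal.ofReal_mul (by positivity),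
    ← ENNReal.ofReal_rpow_of_nonneg hF hs, ← ENNReal.ofReal_rpow_of_nonneg hG ht,
    ofReal_integral_eq_lintegral_ofReal hi (Eventually.of_forall hn),
    ofReal_integral_eq_lintegral_ofReal hf (Eventually.of_forall hf0),
    ofReal_integral_eq_lintegral_ofReal hg (Eventually.of_forall hg0)]
  refine le_trans (le_of_eq ?_) (ENNReal.lintegral_mul_norm_pow_le
    hf.1.aemeasurable.ennreal_ofReal hg.1.aemeasurable.ennreal_ofReal hs ht hst)
  refine lintegral_congr fun x => ?_
  rw [ENNReal.ofReal_mul (Real.rpow_nonneg (hf0 x) _), ENNReal.ofReal_rpow_of_nonneg (hf0 x) hs,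
    ENNReal.ofReal_rpow_of_nonneg (hg0 x) ht]

section Regularization

/-- A smooth approximation of `|s| ^ p`. -/
def powReg (p δ s : ℝ) : ℝ := (s ^ 2 + δ) ^ (p / 2) - δ ^ (p / 2)

/-- The derivative of `powReg`. -/
def powRegDeriv (p δ s : ℝ) : ℝ := p * s * (s ^ 2 + δ) ^ (p / 2 - 1)

theorem contDiff_powReg (p : ℝ) {δ : ℝ} (hδ : 0 < δ) : ContDiff ℝ 1 (powReg p δ) := by
  refine ContDiff.sub (ContDiff.rpow_const_of_ne ?_ fun s => ?_) contDiff_const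
  · fun_prop
  · positivity

theorem hasDerivAt_powReg (p : ℝ) {δ : ℝ} (hδ : 0 < δ) (s : ℝ) :
    HasDerivAt (powReg p δ) (powRegDeriv p δ s) s := by
  have h1 : HasDerivAt (fun s : ℝ => s ^ 2 + δ) (2 * s) s := by
    simpa using (hasDerivAt_pow 2 s).add_const δ
  have h2 := (h1.rpow_const (p := p / 2) (Or.inl (by positivity))).sub_const (δ ^ (p / 2))
  refine h2.congr_deriv ?_
  rw [powRegDeriv]; ring

/-- The reason for subtracting `δ ^ (p / 2)`: the regularized power of `φ` still vanishes wherever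
`φ` does, so compact support is kept. -/
theorem powReg_zero (p δ : ℝ) : powReg p δ 0 = 0 := by simp [powReg]

theorem powRegDeriv_zero (p δ : ℝ) : powRegDeriv p δ 0 = 0 := by simp [powRegDeriv]

variable {p δ : ℝ}

theorem abs_powReg_le (hp : 0 ≤ p) (hδ : 0 < δ) (hδ1 : δ ≤ 1) (s : ℝ) :
    |powReg p δ s| ≤ (s ^ 2 + 1) ^ (p / 2) := by
  have h1 : δ ^ (p / 2) ≤ (s ^ 2 + δ) ^ (p / 2) :=
    Real.rpow_le_rpow hδ.le (by nlinarith [sq_nonneg s]) (by positivity)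
  have h2 : (s ^ 2 + δ) ^ (p / 2) ≤ (s ^ 2 + 1) ^ (p / 2) :=
    Real.rpow_le_rpow (by positivity) (by linarith) (by positivity)
  have h3 : 0 ≤ δ ^ (p / 2) := by positivity
  rw [powReg, abs_of_nonneg (by linarith)]
  linarith

/-- From `|s| ≤ (s² + δ)^(1/2)` the remaining exponent is `(p - 1) / 2`, which is nonnegative since
`p ≥ 1`; hence a bound uniform in `δ`. -/
theorem abs_powRegDeriv_le (hp : 1 ≤ p) (hδ : 0 < δ) (hδ1 : δ ≤ 1) (s : ℝ) :
    |powRegDeriv p δ s| ≤ p * (s ^ 2 + 1) ^ (p / 2) := by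
  have hq : 0 < s ^ 2 + δ := by positivity
  have h1 : |s| ≤ (s ^ 2 + δ) ^ (1 / 2 : ℝ) := by
    rw [← Real.sqrt_eq_rpow]
    exact Real.abs_le_sqrt (by linarith)
  rw [powRegDeriv, abs_mul, abs_mul, abs_of_nonneg (by linarith : 0 ≤ p),
    abs_of_nonneg (by positivity : 0 ≤ (s ^ 2 + δ) ^ (p / 2 - 1)), mul_assoc]
  refine mul_le_mul_of_nonneg_left ?_ (by linarith)
  calc |s| * (s ^ 2 + δ) ^ (p / 2 - 1)
      ≤ (s ^ 2 + δ) ^ (1 / 2 : ℝ) * (s ^ 2 + δ) ^ (p / 2 - 1) := by gcongr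
    _ = (s ^ 2 + δ) ^ ((p - 1) / 2) := by rw [← Real.rpow_add hq]; ring_nf
    _ ≤ (s ^ 2 + 1) ^ ((p - 1) / 2) :=
      Real.rpow_le_rpow hq.le (by linarith) (by linarith)
    _ ≤ (s ^ 2 + 1) ^ (p / 2) :=
      Real.rpow_le_rpow_of_exponent_le (by nlinarith [sq_nonneg s]) (by linarith)

theorem tendsto_powReg (hp : 1 ≤ p) (s : ℝ) :
    Tendsto (fun δ => powReg p δ s) (𝓝[>] 0) (𝓝 (powReg p 0 s)) := by
  refine Tendsto.mono_left ?_ nhdsWithin_le_nhds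
  refine Tendsto.sub ?_ ?_
  · exact ((continuous_const.add continuous_id).rpow_const
      fun _ => Or.inr (by linarith)).tendsto (0 : ℝ)
  · exact (continuous_id.rpow_const fun _ => Or.inr (by linarith)).tendsto (0 : ℝ)

theorem tendsto_rpow_add {q : ℝ} (hq : 0 < q) (r : ℝ) :
    Tendsto (fun δ : ℝ => (q + δ) ^ r) (𝓝[>] 0) (𝓝 ((q + 0) ^ r)) := by
  refine Tendsto.mono_left ?_ nhdsWithin_le_nhds
  exact ((continuous_const.add continuous_id).continuousAt (x := (0 : ℝ))).rpow_const
    (Or.inl (by simpa using hq.ne'))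

theorem tendsto_powRegDeriv (s : ℝ) :
    Tendsto (fun δ => powRegDeriv p δ s) (𝓝[>] 0) (𝓝 (powRegDeriv p 0 s)) := by
  -- At `s = 0` the power `δ ^ (p / 2 - 1)` may blow up when `p < 2`, but the factor `s` makes the
  -- derivative zero for every `δ`.
  rcases eq_or_ne s 0 with rfl | hs
  · simp [powRegDeriv_zero]
  · exact (tendsto_rpow_add (by positivity) _).const_mul _

theorem powReg_eq (hp : 1 ≤ p) (s : ℝ) : powReg p 0 s = |s| ^ p := by
  rw [powReg, Real.zero_rpow (by linarith), sub_zero, add_zero, ← sq_abs, ← Real.rpow_natCast,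
    ← Real.rpow_mul (abs_nonneg s)]
  congr 1; push_cast; ring

/-- `powRegDeriv p 0 s` plays the role of `p |s|^(p-2) s`, with value `0` at `s = 0` also when `p <
2`. -/
theorem powRegDeriv_zero_mul (hp : 1 ≤ p) (s : ℝ) : powRegDeriv p 0 s * s = p * |s| ^ p := by
  rcases eq_or_ne s 0 with rfl | hs
  · simp [Real.zero_rpow (by linarith : p ≠ 0)]
  · rw [← powReg_eq hp, powReg, powRegDeriv, Real.zero_rpow (by linarith), add_zero, sub_zero,
      Real.rpow_sub_one (by positivity)]
    field_simp

theorem abs_powRegDeriv_zero_le (hp : 1 ≤ p) (s : ℝ) :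
    |powRegDeriv p 0 s| ≤ p * |s| ^ (p - 1) := by
  rcases eq_or_ne s 0 with rfl | hs
  · rw [powRegDeriv_zero, abs_zero]
    have := Real.rpow_nonneg (abs_nonneg (0 : ℝ)) (p - 1)
    positivity
  · have hs' : 0 < |s| := abs_pos.2 hs
    have h := congrArg abs (powRegDeriv_zero_mul hp s)
    rw [abs_mul, abs_of_nonneg (by positivity : 0 ≤ p * |s| ^ p)] at h
    rw [Real.rpow_sub_one hs'.ne', ← mul_div_assoc, le_div_iff₀ hs', h]

end Regularization

variable {n : ℕ} {M : Set (Space n)}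

/-- The trace of the projection onto a hyperplane, which is the identity `div_T x = n`. -/
theorem sum_tproj_single {ν : Space n} (hν : ‖ν‖ = 1) :
    ∑ i, tproj ν (EuclideanSpace.single i (1 : ℝ)) i = n := by
  have h1 : ∀ i, tproj ν (EuclideanSpace.single i (1 : ℝ)) i = 1 - ν i ^ 2 := by
    intro i
    simp [tproj, EuclideanSpace.inner_single_left, sq]
  have h2 : ∑ i, ν i ^ 2 = 1 := by
    have := EuclideanSpace.real_norm_sq_eq ν
    rw [hν] at this
    linarith
  rw [Finset.sum_congr rfl fun i _ => h1 i, Finset.sum_sub_distrib, h2]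
  simp

theorem gradient_mul {f g : Space n → ℝ} {x : Space n} (hf : DifferentiableAt ℝ f x)
    (hg : DifferentiableAt ℝ g x) :
    ∇ (fun y => f y * g y) x = f x • ∇ g x + g x • ∇ f x := by
  simp [gradient, fderiv_fun_mul hf hg]

theorem gradient_coord (i : Fin (n + 1)) (x : Space n) :
    ∇ (fun y : Space n => y i) x = EuclideanSpace.single i 1 := by
  refine ext_inner_right ℝ fun v => ?_
  rw [inner_gradient_left]
  have : HasFDerivAt (fun y : Space n => y i) (EuclideanSpace.proj i : Space n →L[ℝ] ℝ) x :=
    (EuclideanSpace.proj i : Space n →L[ℝ] ℝ).hasFDerivAt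
  rw [this.fderiv, EuclideanSpace.inner_single_left]
  simp

/-- The divergence theorem for the vector field `h x`. -/
theorem integral_mul_position (hM : IsSmoothHypersurface M) (hn : 0 < n) {h : Space n → ℝ}
    (hh : ∀ x ∈ M, ∃ ψ, IsC1ExtensionNear M h x ψ) {K : Set (Space n)} (hK : IsCompact K)
    (hKM : K ⊆ M) (hhK : ∀ x ∈ M, x ∉ K → h x = 0) :
    ∫ x in K, (n * h x + inner ℝ (tangentialGradient M h x) x
      - h x * inner ℝ (meanCurvatureVector M x) x) ∂μHE[n] = 0 := by
  -- The divergence theorem is applied to each function `h x_i` in the direction of the `i`-th basis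
  -- vector, and the results are summed.
  have hc : ∀ i : Fin (n + 1), ∀ x ∈ M, ∃ ψ, IsC1ExtensionNear M (fun y => h y * y i) x ψ := by
    intro i x hx
    obtain ⟨ψ, h1, h2⟩ := hh x hx
    exact ⟨fun y => ψ y * y i, h1.mul (by fun_prop), h2.mono fun y hy => by simp only [hy]⟩
  have hcK : ∀ i : Fin (n + 1), ∀ x ∈ M, x ∉ K → h x * x i = 0 := fun i x hx hxK => by
    rw [hhK x hx hxK, zero_mul]
  have hpt : ∀ x ∈ M, n * h x + inner ℝ (tangentialGradient M h x) x
      - h x * inner ℝ (meanCurvatureVector M x) x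
      = ∑ i, (inner ℝ (EuclideanSpace.single i (1 : ℝ)) (defect M (fun y => h y * y i) x) : ℝ) := by
    intro x hx
    obtain ⟨F, u, hg⟩ := hM.exists_isGraphNear hx
    obtain ⟨ψ, h1, h2⟩ := hh x hx
    have hψx : ψ x = h x := h2.self_of_nhdsWithin hx
    set ν := F.normal u (F.π x)
    have ht : ∀ i : Fin (n + 1), tangentialGradient M (fun y => h y * y i) x
        = h x • tproj ν (EuclideanSpace.single i 1) + x i • tproj ν (∇ ψ x) := by
      intro i
      rw [hg.tangentialGradient_eq hM (ψ := fun y => ψ y * y i)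
        ⟨h1.mul (by fun_prop), h2.mono fun y hy => by simp only [hy]⟩,
        hg.ambientTangentialGradient_eq hM,
        gradient_mul (h1.differentiableAt one_ne_zero) (by fun_prop), gradient_coord, tproj_add,
        tproj_smul, tproj_smul, hψx]
    have hi : ∀ i : Fin (n + 1),
        (inner ℝ (EuclideanSpace.single i (1 : ℝ)) (defect M (fun y => h y * y i) x) : ℝ)
        = h x * tproj ν (EuclideanSpace.single i 1) i + x i * tproj ν (∇ ψ x) i
          - h x * (x i * meanCurvatureVector M x i) := by
      intro i
      rw [EuclideanSpace.inner_single_left, defect, ht]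
      simp
      ring
    rw [Finset.sum_congr rfl fun i _ => hi i, Finset.sum_sub_distrib, Finset.sum_add_distrib,
      ← Finset.mul_sum, ← Finset.mul_sum, sum_tproj_single (F.norm_normal _),
      hg.tangentialGradient_eq hM ⟨h1, h2⟩, hg.ambientTangentialGradient_eq hM, PiLp.inner_apply,
      PiLp.inner_apply]
    simp only [RCLike.inner_apply, conj_trivial]
    ring
  rw [setIntegral_congr_fun hK.measurableSet fun x hx => hpt x (hKM hx), integral_finsetSum]
  · refine Finset.sum_eq_zero fun i _ => ?_
    rw [← integral_inner_defect hM hn (hc i) hK hKM (hcK i) (EuclideanSpace.single i (1 : ℝ)),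
      integral_vol_eq hM hKM]
    intro x hx hxK
    rw [defect_eq_zero hM hK (hcK i) hx hxK, inner_zero_right]
  · intro i _
    exact integrableOn_of_continuousOn hM hn (continuousOn_inner_defect hM (hc i) _) hK hKM

/-- The integrand of the divergence theorem for the regularization of `|φ| ^ p |x| ^ (-a) x`. -/
def regIntegrand (M : Set (Space n)) (φ : Space n → ℝ) (p a δ : ℝ) (x : Space n) : ℝ :=
  powReg p δ (φ x) * (n * (‖x‖ ^ 2 + δ) ^ (-a / 2)
    - a * ((‖x‖ ^ 2 + δ) ^ (-a / 2 - 1) * (‖x‖ ^ 2 - inner ℝ x (unitNormal M x) ^ 2)))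
  + (powRegDeriv p δ (φ x) * inner ℝ (tangentialGradient M φ x) x
    - powReg p δ (φ x) * inner ℝ (meanCurvatureVector M x) x) * (‖x‖ ^ 2 + δ) ^ (-a / 2)

theorem gradient_weight (a : ℝ) {δ : ℝ} (hδ : 0 < δ) (x : Space n) :
    ∇ (fun y : Space n => (‖y‖ ^ 2 + δ) ^ (-a / 2)) x
      = (-a * (‖x‖ ^ 2 + δ) ^ (-a / 2 - 1)) • x := by
  refine ext_inner_right ℝ fun v => ?_
  have h1 : HasFDerivAt (fun y : Space n => ‖y‖ ^ 2 + δ) (2 • innerSL ℝ x) x :=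
    (hasStrictFDerivAt_norm_sq x).hasFDerivAt.add_const δ
  have h2 := h1.rpow_const (p := -a / 2) (Or.inl (by positivity))
  rw [inner_gradient_left, h2.fderiv, inner_smul_left]
  simp
  ring

/-- `integral_mul_position` with `h = powReg p δ φ · (|x|² + δ)^(-a/2)`. The factor `|x|² - (x ·
ν)²` is the inner product of `x` with its tangential part, produced by the gradient of the weight.
-/
theorem integral_regIntegrand (hM : IsSmoothHypersurface M) (hn : 0 < n) {φ : Space n → ℝ}
    (hφ : ∀ x ∈ M, ∃ ψ, IsC1ExtensionNear M φ x ψ) {K : Set (Space n)} (hK : IsCompact K)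
    (hKM : K ⊆ M) (hφK : ∀ x ∈ M, x ∉ K → φ x = 0) (p a : ℝ) {δ : ℝ} (hδ : 0 < δ) :
    ∫ x in K, regIntegrand M φ p a δ x ∂μHE[n] = 0 := by
  set R : Space n → ℝ := fun y => (‖y‖ ^ 2 + δ) ^ (-a / 2)
  have hR : ContDiff ℝ 1 R :=
    ((contDiff_norm_sq ℝ).add contDiff_const).rpow_const_of_ne fun y => by positivity
  have hext : ∀ x ∈ M, ∀ ψ, IsC1ExtensionNear M φ x ψ →
      IsC1ExtensionNear M (fun y => powReg p δ (φ y) * R y) x fun y => powReg p δ (ψ y) * R y :=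
    fun x hx ψ hψ => ⟨((contDiff_powReg p hδ).contDiffAt.comp x hψ.1).mul hR.contDiffAt,
      hψ.2.mono fun y hy => by simp only [hy]⟩
  rw [← integral_mul_position hM hn (h := fun y => powReg p δ (φ y) * R y)
    (fun x hx => let ⟨ψ, hψ⟩ := hφ x hx; ⟨_, hext x hx ψ hψ⟩) hK hKM
    fun x hx hxK => by rw [hφK x hx hxK, powReg_zero, zero_mul]]
  refine setIntegral_congr_fun hK.measurableSet fun x hxK => ?_
  have hx := hKM hxK
  obtain ⟨F, u, hg⟩ := hM.exists_isGraphNear hx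
  obtain ⟨ψ, hψ⟩ := hφ x hx
  have hψx : ψ x = φ x := hψ.2.self_of_nhdsWithin hx
  have hψd : DifferentiableAt ℝ ψ x := hψ.1.differentiableAt one_ne_zero
  have hcomp : ∇ (fun y => powReg p δ (ψ y)) x = powRegDeriv p δ (φ x) • ∇ ψ x := by
    have := (hasDerivAt_powReg p hδ (ψ x)).comp_hasFDerivAt x hψd.hasFDerivAt
    simp only [gradient]
    rw [show (fun y => powReg p δ (ψ y)) = powReg p δ ∘ ψ from rfl, this.fderiv, hψx]
    simp
  have hdc : DifferentiableAt ℝ (fun y => powReg p δ (ψ y)) x :=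
    (((contDiff_powReg p hδ).contDiffAt.comp x hψ.1)).differentiableAt one_ne_zero
  have hxx : inner ℝ (tproj (F.normal u (F.π x)) x) x
      = ‖x‖ ^ 2 - inner ℝ x (unitNormal M x) ^ 2 := by
    rw [← hg.tproj_unitNormal hM, tproj, inner_sub_left, inner_smul_left,
      real_inner_self_eq_norm_sq, real_inner_comm]
    simp [sq]
  simp only [regIntegrand]
  rw [hg.tangentialGradient_eq hM hψ, hg.tangentialGradient_eq hM (hext x hx ψ hψ),
    hg.ambientTangentialGradient_eq hM, hg.ambientTangentialGradient_eq hM,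
    gradient_mul hdc (hR.differentiable one_ne_zero).differentiableAt, hcomp,
    gradient_weight a hδ, tproj_add, tproj_smul, tproj_smul, tproj_smul, tproj_smul,
    inner_add_left, inner_smul_left, inner_smul_left, inner_smul_left, inner_smul_left, hxx, hψx]
  simp only [conj_trivial, R]
  ring

end Hypersurface

end

/-! ### The weighted Hardy inequality and the minimal case -/

noncomputable section

namespace Hypersurface

variable {n : ℕ} {M : Set (Space n)}

theorem inner_sq_le_of_norm_eq_one {x ν : Space n} (hν : ‖ν‖ = 1) :
    (inner ℝ x ν : ℝ) ^ 2 ≤ ‖x‖ ^ 2 := by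
  have h := abs_real_inner_le_norm x ν
  rw [hν, mul_one] at h
  exact sq_le_sq' (abs_le.1 h).1 (abs_le.1 h).2

theorem continuousOn_regIntegrand (hM : IsSmoothHypersurface M) {φ : Space n → ℝ}
    (hφ : ∀ x ∈ M, ∃ ψ, IsC1ExtensionNear M φ x ψ) (p a : ℝ) {δ : ℝ} (hδ : 0 < δ) :
    ContinuousOn (regIntegrand M φ p a δ) M := by
  have h1 : ContinuousOn φ M := IsC1c.continuousOn hφ
  have h2 := continuousOn_tangentialGradient hM hφ
  have h3 := continuousOn_meanCurvatureVector hM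
  have h4 := continuousOn_inner_unitNormal_sq hM
  have hR : ∀ r : ℝ, ContinuousOn (fun x : Space n => (‖x‖ ^ 2 + δ) ^ r) M := fun r =>
    Continuous.continuousOn (by
      refine Continuous.rpow_const (by fun_prop) fun x => Or.inl ?_
      positivity)
  have hP : ContinuousOn (fun x => powReg p δ (φ x)) M :=
    (contDiff_powReg p hδ).continuous.comp_continuousOn h1
  have hP' : ContinuousOn (fun x => powRegDeriv p δ (φ x)) M := by
    have : Continuous (powRegDeriv p δ) := by
      refine Continuous.mul (by fun_prop)
        (Continuous.rpow_const (by fun_prop) fun s => Or.inl ?_)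
      positivity
    exact this.comp_continuousOn h1
  have hn : ContinuousOn (fun x : Space n => ‖x‖ ^ 2) M := (continuous_norm.pow 2).continuousOn
  refine ContinuousOn.add (hP.mul ((continuousOn_const.mul (hR _)).sub
    (continuousOn_const.mul ((hR _).mul (hn.sub h4))))) (ContinuousOn.mul ?_ (hR _))
  exact (hP'.mul (h2.inner continuousOn_id)).sub (hP.mul (h3.inner continuousOn_id))

/-- A bound for `regIntegrand` that is uniform in `δ`. -/
def regBound (M : Set (Space n)) (φ : Space n → ℝ) (p a : ℝ) (x : Space n) : ℝ :=
  (φ x ^ 2 + 1) ^ (p / 2) * (n + a + p * (‖tangentialGradient M φ x‖ * ‖x‖)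
    + ‖meanCurvatureVector M x‖ * ‖x‖)

theorem continuousOn_regBound (hM : IsSmoothHypersurface M) {φ : Space n → ℝ}
    (hφ : ∀ x ∈ M, ∃ ψ, IsC1ExtensionNear M φ x ψ) (p a : ℝ) :
    ContinuousOn (regBound M φ p a) M := by
  have h1 : ContinuousOn φ M := IsC1c.continuousOn hφ
  have h2 := (continuousOn_tangentialGradient hM hφ).norm
  have h3 := (continuousOn_meanCurvatureVector hM).norm
  have hn : ContinuousOn (fun x : Space n => ‖x‖) M := continuous_norm.continuousOn
  have hQ : ContinuousOn (fun x => (φ x ^ 2 + 1) ^ (p / 2)) M := by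
    refine ContinuousOn.rpow_const (by fun_prop) fun x _ => Or.inl ?_
    positivity
  exact hQ.mul ((continuousOn_const.add (continuousOn_const.mul (h2.mul hn))).add (h3.mul hn))

theorem sq_norm_rpow (x : Space n) (r : ℝ) : (‖x‖ ^ 2) ^ (r / 2) = ‖x‖ ^ r := by
  rw [← Real.rpow_natCast, ← Real.rpow_mul (norm_nonneg x)]
  congr 1; push_cast; ring

/-- Since `a ≥ 0`, adding `δ` only decreases the weight, and `|x|² - (x · ν)² ≤ |x|² + δ`
compensates the extra negative power in its derivative. The dominating function is then a continuous
one times `|x|^(-a)`. -/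
theorem abs_regIntegrand_le (hM : IsSmoothHypersurface M) {φ : Space n → ℝ} {p a δ : ℝ}
    (hp : 1 ≤ p) (ha : 0 ≤ a) (hδ : 0 < δ) (hδ1 : δ ≤ 1) {x : Space n} (hx : x ∈ M)
    (hx0 : x ≠ 0) : |regIntegrand M φ p a δ x| ≤ regBound M φ p a x * ‖x‖ ^ (-a) := by
  have hx0' : 0 < ‖x‖ := norm_pos_iff.2 hx0
  set Q := (φ x ^ 2 + 1) ^ (p / 2)
  set w := ‖x‖ ^ (-a)
  have hQ : 0 ≤ Q := by positivity
  have hw : 0 ≤ w := by positivity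
  have hq : 0 < ‖x‖ ^ 2 + δ := by positivity
  have hP := abs_powReg_le (by linarith : 0 ≤ p) hδ hδ1 (φ x)
  have hP' := abs_powRegDeriv_le hp hδ hδ1 (φ x)
  have hR : (‖x‖ ^ 2 + δ) ^ (-a / 2) ≤ w := by
    rw [show w = _ from (sq_norm_rpow x (-a)).symm]
    exact Real.rpow_le_rpow_of_nonpos (by positivity) (by linarith) (by linarith)
  have hR0 : 0 ≤ (‖x‖ ^ 2 + δ) ^ (-a / 2) := by positivity
  have hν := inner_sq_le_of_norm_eq_one (x := x) (norm_unitNormal hM hx)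
  have hν0 := sq_nonneg (inner ℝ x (unitNormal M x) : ℝ)
  have hS : |(‖x‖ ^ 2 + δ) ^ (-a / 2 - 1) * (‖x‖ ^ 2 - inner ℝ x (unitNormal M x) ^ 2)| ≤ w := by
    rw [abs_of_nonneg (mul_nonneg (by positivity) (by linarith))]
    calc _ ≤ (‖x‖ ^ 2 + δ) ^ (-a / 2 - 1) * (‖x‖ ^ 2 + δ) := by gcongr; linarith
      _ = (‖x‖ ^ 2 + δ) ^ (-a / 2) := by
        rw [Real.rpow_sub_one hq.ne', div_mul_cancel₀ _ hq.ne']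
      _ ≤ w := hR
  have e1 : |(n : ℝ) * (‖x‖ ^ 2 + δ) ^ (-a / 2)
      - a * ((‖x‖ ^ 2 + δ) ^ (-a / 2 - 1) * (‖x‖ ^ 2 - inner ℝ x (unitNormal M x) ^ 2))|
      ≤ n * w + a * w := by
    refine (abs_sub _ _).trans (add_le_add ?_ ?_)
    · rw [abs_mul, abs_of_nonneg hR0, Nat.abs_cast]; gcongr
    · rw [abs_mul, abs_of_nonneg ha]; gcongr
  have e2 : |powRegDeriv p δ (φ x) * inner ℝ (tangentialGradient M φ x) x
      - powReg p δ (φ x) * inner ℝ (meanCurvatureVector M x) x|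
      ≤ p * Q * (‖tangentialGradient M φ x‖ * ‖x‖)
        + Q * (‖meanCurvatureVector M x‖ * ‖x‖) := by
    refine (abs_sub _ _).trans (add_le_add ?_ ?_)
    · rw [abs_mul]
      exact mul_le_mul hP' (abs_real_inner_le_norm _ _) (abs_nonneg _) (by positivity)
    · rw [abs_mul]
      exact mul_le_mul hP (abs_real_inner_le_norm _ _) (abs_nonneg _) hQ
  rw [regIntegrand, regBound]
  refine (abs_add_le _ _).trans ?_
  rw [abs_mul, abs_mul _ ((‖x‖ ^ 2 + δ) ^ (-a / 2)), abs_of_nonneg hR0]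
  calc _ ≤ Q * (n * w + a * w) + (p * Q * (‖tangentialGradient M φ x‖ * ‖x‖)
        + Q * (‖meanCurvatureVector M x‖ * ‖x‖)) * w := by
        refine add_le_add (mul_le_mul hP e1 (abs_nonneg _) hQ) (mul_le_mul e2 hR hR0 (by positivity))
    _ = _ := by ring

theorem integral_regIntegrand_zero (hM : IsSmoothHypersurface M) (hn : 0 < n) {φ : Space n → ℝ}
    (hφ : ∀ x ∈ M, ∃ ψ, IsC1ExtensionNear M φ x ψ) {K : Set (Space n)} (hK : IsCompact K)
    (hKM : K ⊆ M) (hφK : ∀ x ∈ M, x ∉ K → φ x = 0) {p a : ℝ} (hp : 1 ≤ p) (ha : 0 ≤ a)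
    (han : a < n) :
    IntegrableOn (regIntegrand M φ p a 0) K μHE[n] ∧
      ∫ x in K, regIntegrand M φ p a 0 x ∂μHE[n] = 0 := by
  have hbound := integrableOn_mul_rpow hM hn (continuousOn_regBound hM hφ p a) hK hKM han
  have hmeas : ∀ δ > 0, AEStronglyMeasurable (regIntegrand M φ p a δ) ((μHE[n]).restrict K) :=
    fun δ hδ => ((continuousOn_regIntegrand hM hφ p a hδ).mono hKM).aestronglyMeasurable
      hK.measurableSet
  have hle : ∀ᶠ δ in 𝓝[>] (0 : ℝ), ∀ᵐ x ∂(μHE[n]).restrict K,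
      ‖regIntegrand M φ p a δ x‖ ≤ regBound M φ p a x * ‖x‖ ^ (-a) := by
    filter_upwards [Ioo_mem_nhdsGT one_pos] with δ hδ
    filter_upwards [ae_restrict_mem hK.measurableSet, ae_ne_zero hn K] with x hx hx0
    exact abs_regIntegrand_le hM hp ha hδ.1 hδ.2.le (hKM hx) hx0
  have hlim : ∀ᵐ x ∂(μHE[n]).restrict K,
      Tendsto (fun δ => regIntegrand M φ p a δ x) (𝓝[>] 0) (𝓝 (regIntegrand M φ p a 0 x)) := by
    filter_upwards [ae_ne_zero hn K] with x hx0
    have hx0' : 0 < ‖x‖ ^ 2 := pow_pos (norm_pos_iff.2 hx0) 2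
    exact ((tendsto_powReg hp _).mul (((tendsto_rpow_add hx0' _).const_mul _).sub
      (((tendsto_rpow_add hx0' _).mul_const _).const_mul _))).add
      ((((tendsto_powRegDeriv _).mul_const _).sub ((tendsto_powReg hp _).mul_const _)).mul
        (tendsto_rpow_add hx0' _))
  constructor
  · refine Integrable.mono' hbound ?_ ?_
    -- Measurability of the limit integrand comes from its being an a.e. limit of functions
    -- continuous on `M`, along a sequence of `δ`.
    · have hseq : Tendsto (fun k : ℕ => 1 / ((k : ℝ) + 1)) atTop (𝓝[>] 0) :=
        tendsto_nhdsWithin_iff.2 ⟨tendsto_one_div_add_atTop_nhds_zero_nat,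
          Eventually.of_forall fun k => by simp only [Set.mem_Ioi]; positivity⟩
      exact aestronglyMeasurable_of_tendsto_ae atTop
        (fun k : ℕ => hmeas (1 / ((k : ℝ) + 1)) (by positivity))
        (hlim.mono fun x hx => hx.comp hseq)
    · filter_upwards [ae_restrict_mem hK.measurableSet, ae_ne_zero hn K, hlim] with x hx hx0 hl
      refine le_of_tendsto hl.norm ?_
      filter_upwards [Ioo_mem_nhdsGT one_pos] with δ hδ
      exact abs_regIntegrand_le hM hp ha hδ.1 hδ.2.le (hKM hx) hx0
  · have ht := tendsto_integral_filter_of_dominated_convergence (l := 𝓝[>] (0 : ℝ))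
      (fun x => regBound M φ p a x * ‖x‖ ^ (-a))
      (eventually_nhdsWithin_of_forall fun δ hδ => hmeas δ hδ) hle hbound hlim
    refine tendsto_nhds_unique ht (Tendsto.congr' ?_ tendsto_const_nhds)
    exact eventually_nhdsWithin_of_forall fun δ hδ =>
      (integral_regIntegrand hM hn hφ hK hKM hφK p a hδ).symm

/-- With `W = p ∇_T φ - φ 𝓗`, the left-hand side is exactly `regIntegrand` at `δ = 0` minus
`|φ|^(p-2) φ W · x |x|^(-a)`, and Cauchy–Schwarz bounds the latter in absolute value by `|φ|^(p-1)
|W| |x|^(1-a)`. That product is written as the integrand for Hölder with exponents `(p - 1) / p` and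
`1 / p`. -/
theorem le_regIntegrand_zero_add (M : Set (Space n)) (φ : Space n → ℝ) {p a : ℝ} (hp : 1 ≤ p)
    {x : Space n} (hx0 : x ≠ 0) :
    (n - a) * (|φ x| ^ p / ‖x‖ ^ a)
      + a * (inner ℝ (‖x‖⁻¹ • x) (unitNormal M x) ^ 2 * (|φ x| ^ p / ‖x‖ ^ a))
    ≤ regIntegrand M φ p a 0 x + (|φ x| ^ p / ‖x‖ ^ a) ^ ((p - 1) / p)
      * (‖p • tangentialGradient M φ x - φ x • meanCurvatureVector M x‖ ^ p
        / ‖x‖ ^ (a - p)) ^ (1 / p) := by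
  have hr : 0 < ‖x‖ := norm_pos_iff.2 hx0
  have hp0 : p ≠ 0 := by linarith
  set r := ‖x‖
  set W := p • tangentialGradient M φ x - φ x • meanCurvatureVector M x with hW
  set T := tangentialGradient M φ x
  set H := meanCurvatureVector M x
  -- The powers of `r` combine by `a (p - 1) / p + (a - p) / p = a - 1`.
  have hH : (|φ x| ^ p / r ^ a) ^ ((p - 1) / p) * (‖W‖ ^ p / r ^ (a - p)) ^ (1 / p)
      = |φ x| ^ (p - 1) * ‖W‖ * (r * r ^ (-a)) := by
    rw [Real.div_rpow (by positivity) (by positivity), Real.div_rpow (by positivity) (by positivity),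
      ← Real.rpow_mul (abs_nonneg _), ← Real.rpow_mul (norm_nonneg W), ← Real.rpow_mul hr.le,
      ← Real.rpow_mul hr.le, mul_div_cancel₀ _ hp0, mul_one_div_cancel hp0, Real.rpow_one,
      div_mul_div_comm, ← Real.rpow_add hr, div_eq_mul_inv, ← Real.rpow_neg hr.le]
    rw [show r * r ^ (-a) = r ^ (1 + -a) by rw [Real.rpow_add hr, Real.rpow_one]]
    congr 2
    field_simp
    ring
  have hF := powReg_eq hp (φ x)
  have e1 : (r ^ 2 + 0) ^ (-a / 2) = r ^ (-a) := by rw [add_zero]; exact sq_norm_rpow x (-a)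
  have e2 : (r ^ 2 + 0) ^ (-a / 2 - 1) = r ^ (-a) / r ^ 2 := by
    rw [Real.rpow_sub_one (by positivity), e1, add_zero]
  have hc : powRegDeriv p 0 (φ x) * inner ℝ T x - |φ x| ^ p * inner ℝ H x
      = p⁻¹ * powRegDeriv p 0 (φ x) * inner ℝ W x := by
    have := powRegDeriv_zero_mul hp (φ x)
    rw [hW, inner_sub_left, inner_smul_left, inner_smul_left]
    simp only [conj_trivial]
    field_simp
    linear_combination (inner ℝ H x : ℝ) * this
  have hb : -(p⁻¹ * powRegDeriv p 0 (φ x) * inner ℝ W x) ≤ |φ x| ^ (p - 1) * ‖W‖ * r := by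
    refine (neg_le_abs _).trans ?_
    rw [abs_mul, abs_mul, abs_of_nonneg (by positivity : 0 ≤ p⁻¹), mul_assoc (|φ x| ^ (p - 1))]
    refine mul_le_mul ?_ (abs_real_inner_le_norm _ _) (abs_nonneg _)
      (Real.rpow_nonneg (abs_nonneg _) _)
    rw [inv_mul_le_iff₀ (by linarith)]
    exact abs_powRegDeriv_zero_le hp _
  have hν : inner ℝ (r⁻¹ • x) (unitNormal M x) ^ 2 = inner ℝ x (unitNormal M x) ^ 2 / r ^ 2 := by
    rw [inner_smul_left]; simp only [conj_trivial]; field_simp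
  have hra : |φ x| ^ p / r ^ a = |φ x| ^ p * r ^ (-a) := by
    rw [Real.rpow_neg hr.le, div_eq_mul_inv]
  rw [hH, regIntegrand, hF, hc, hν, hra, e1, e2]
  have hw : 0 ≤ r ^ (-a) := by positivity
  have key := mul_le_mul_of_nonneg_right hb hw
  have e3 : |φ x| ^ p * (n * r ^ (-a)
      - a * (r ^ (-a) / r ^ 2 * (r ^ 2 - inner ℝ x (unitNormal M x) ^ 2)))
      = (n - a) * (|φ x| ^ p * r ^ (-a))
        + a * (inner ℝ x (unitNormal M x) ^ 2 / r ^ 2 * (|φ x| ^ p * r ^ (-a))) := by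
    field_simp
    ring
  rw [e3]
  linarith

/-- The weighted Hardy inequality on a hypersurface. -/
theorem hardy_weighted (hM : IsSmoothHypersurface M) {φ : Space n → ℝ} (hφ : IsC1c M φ) {p a : ℝ}
    (hp : 1 ≤ p) (ha : 0 ≤ a) (han : a < n) :
    Integrable (fun x => |φ x| ^ p / ‖x‖ ^ a) (vol M) ∧
    Integrable (fun x => (inner ℝ (‖x‖⁻¹ • x) (unitNormal M x)) ^ 2
      * (|φ x| ^ p / ‖x‖ ^ a)) (vol M) ∧
    Integrable (fun x => ‖p • tangentialGradient M φ x
      - φ x • meanCurvatureVector M x‖ ^ p / ‖x‖ ^ (a - p)) (vol M) ∧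
    (n - a) * ∫ x, |φ x| ^ p / ‖x‖ ^ a ∂(vol M)
      + a * ∫ x, (inner ℝ (‖x‖⁻¹ • x) (unitNormal M x)) ^ 2 * (|φ x| ^ p / ‖x‖ ^ a) ∂(vol M)
      ≤ (∫ x, |φ x| ^ p / ‖x‖ ^ a ∂(vol M)) ^ ((p - 1) / p)
        * (∫ x, ‖p • tangentialGradient M φ x - φ x • meanCurvatureVector M x‖ ^ p
            / ‖x‖ ^ (a - p) ∂(vol M)) ^ (1 / p) := by
  have hn : 0 < n := by
    have : (0 : ℝ) < n := lt_of_le_of_lt ha han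
    exact_mod_cast this
  have hp0 : p ≠ 0 := by linarith
  obtain ⟨hφ1, K, hKM, hK, hφK⟩ := hφ
  have hKm := hK.measurableSet
  have hφc : ContinuousOn φ M := IsC1c.continuousOn hφ1
  have hdiv : ∀ (c r b : ℝ), 0 ≤ r → c / r ^ b = c * r ^ (-b) := fun c r b hr => by
    rw [Real.rpow_neg hr, div_eq_mul_inv]
  have z1 : ∀ x ∈ M, x ∉ K → |φ x| ^ p / ‖x‖ ^ a = 0 := fun x hx hxK => by
    rw [hφK x hx hxK, abs_zero, Real.zero_rpow hp0, zero_div]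
  have z2 : ∀ x ∈ M, x ∉ K → inner ℝ (‖x‖⁻¹ • x) (unitNormal M x) ^ 2
      * (|φ x| ^ p / ‖x‖ ^ a) = 0 := fun x hx hxK => by rw [z1 x hx hxK, mul_zero]
  have z3 : ∀ x ∈ M, x ∉ K → ‖p • tangentialGradient M φ x
      - φ x • meanCurvatureVector M x‖ ^ p / ‖x‖ ^ (a - p) = 0 := fun x hx hxK => by
    rw [tangentialGradient_eq_zero hM hK hφK hx hxK, hφK x hx hxK]
    simp [Real.zero_rpow hp0]
  have i1 : IntegrableOn (fun x => |φ x| ^ p / ‖x‖ ^ a) K μHE[n] := by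
    simp_rw [fun x : Space n => hdiv (|φ x| ^ p) ‖x‖ a (norm_nonneg x)]
    exact integrableOn_mul_rpow hM hn
      (hφc.abs.rpow_const fun x _ => Or.inr (by linarith)) hK hKM han
  have i2 : IntegrableOn (fun x => inner ℝ (‖x‖⁻¹ • x) (unitNormal M x) ^ 2
      * (|φ x| ^ p / ‖x‖ ^ a)) K μHE[n] := by
    refine Integrable.mono' i1 (AEStronglyMeasurable.mul ?_ i1.1) ?_
    · have e : ∀ x, (inner ℝ (‖x‖⁻¹ • x) (unitNormal M x) : ℝ) ^ 2
          = (‖x‖⁻¹) ^ 2 * inner ℝ x (unitNormal M x) ^ 2 := fun x => by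
        rw [inner_smul_left, mul_pow]; simp
      simp_rw [e]
      refine AEStronglyMeasurable.mul ?_
        (((continuousOn_inner_unitNormal_sq hM).mono hKM).aestronglyMeasurable hKm)
      exact ((measurable_norm.inv).pow_const 2).aestronglyMeasurable
    · filter_upwards [ae_restrict_mem hKm] with x hx
      have h1 : (inner ℝ (‖x‖⁻¹ • x) (unitNormal M x) : ℝ) ^ 2 ≤ 1 := by
        refine (inner_sq_le_of_norm_eq_one (norm_unitNormal hM (hKM hx))).trans ?_
        rw [norm_smul, norm_inv, norm_norm]
        have : ‖x‖⁻¹ * ‖x‖ ≤ 1 := inv_mul_le_one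
        exact pow_le_one₀ (by positivity) this
      have h2 : 0 ≤ |φ x| ^ p / ‖x‖ ^ a := by positivity
      rw [Real.norm_of_nonneg (mul_nonneg (sq_nonneg _) h2)]
      exact mul_le_of_le_one_left h2 h1
  have i3 : IntegrableOn (fun x => ‖p • tangentialGradient M φ x
      - φ x • meanCurvatureVector M x‖ ^ p / ‖x‖ ^ (a - p)) K μHE[n] := by
    simp_rw [fun x : Space n => hdiv (‖p • tangentialGradient M φ x
      - φ x • meanCurvatureVector M x‖ ^ p) ‖x‖ (a - p) (norm_nonneg x)]
    refine integrableOn_mul_rpow hM hn (ContinuousOn.rpow_const ?_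
      fun x _ => Or.inr (by linarith)) hK hKM (by linarith)
    exact (((continuousOn_tangentialGradient hM hφ1).const_smul p).sub
      (hφc.smul (continuousOn_meanCurvatureVector hM))).norm
  refine ⟨(integrable_vol_iff hM hKM z1).2 i1, (integrable_vol_iff hM hKM z2).2 i2,
    (integrable_vol_iff hM hKM z3).2 i3, ?_⟩
  rw [integral_vol_eq hM hKM z1, integral_vol_eq hM hKM z2, integral_vol_eq hM hKM z3]
  obtain ⟨hint, hzero⟩ := integral_regIntegrand_zero hM hn hφ1 hK hKM hφK hp ha han
  obtain ⟨hHi, hHle⟩ := integral_rpow_mul_rpow_le (s := (p - 1) / p) (t := 1 / p) i1 i3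
    (fun x => by positivity) (fun x => by positivity)
    (div_nonneg (by linarith) (by linarith)) (by positivity) (by field_simp; ring)
  refine le_trans ?_ hHle
  rw [← integral_const_mul, ← integral_const_mul, ← integral_add (i1.const_mul _) (i2.const_mul _)]
  -- The pointwise inequality is integrated over `K`; the integral of `regIntegrand` is zero.
  calc _ ≤ ∫ x in K, (regIntegrand M φ p a 0 x + (|φ x| ^ p / ‖x‖ ^ a) ^ ((p - 1) / p)
        * (‖p • tangentialGradient M φ x - φ x • meanCurvatureVector M x‖ ^ p
        / ‖x‖ ^ (a - p)) ^ (1 / p)) ∂μHE[n] := by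
        refine integral_mono_ae ((i1.const_mul _).add (i2.const_mul _)) (hint.add hHi) ?_
        filter_upwards [ae_ne_zero hn K] with x hx0
        exact le_regIntegrand_zero_add M φ hp hx0
    _ = _ := by rw [integral_add hint hHi, hzero, zero_add]

/-- Hardy's inequality on a minimal hypersurface. -/
theorem hardy_minimal (hM : IsSmoothHypersurface M) (hmin : IsMinimal M) {φ : Space n → ℝ}
    (hφ : IsC1c M φ) {p : ℝ} (hp : 1 ≤ p) (hpn : p < n) :
    (n - p) ^ p / p ^ p * ∫ x, |φ x| ^ p / ‖x‖ ^ p ∂(vol M)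
      ≤ ∫ x, ‖tangentialGradient M φ x‖ ^ p ∂(vol M) := by
  have hp0 : 0 < p := by linarith
  obtain ⟨-, -, -, h⟩ := hardy_weighted hM hφ hp hp0.le hpn
  set A := ∫ x, |φ x| ^ p / ‖x‖ ^ p ∂(vol M)
  set B := ∫ x, ‖tangentialGradient M φ x‖ ^ p ∂(vol M) with hB
  have hA0 : 0 ≤ A := integral_nonneg fun x => by positivity
  have hB0 : 0 ≤ B := integral_nonneg fun x => by positivity
  have hC0 : 0 ≤ ∫ x, (inner ℝ (‖x‖⁻¹ • x) (unitNormal M x)) ^ 2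
      * (|φ x| ^ p / ‖x‖ ^ p) ∂(vol M) := integral_nonneg fun x => by positivity
  have hD : ∫ x, ‖p • tangentialGradient M φ x - φ x • meanCurvatureVector M x‖ ^ p
      / ‖x‖ ^ (p - p) ∂(vol M) = p ^ p * B := by
    rw [hB, ← integral_const_mul]
    refine setIntegral_congr_fun hM.measurableSet fun x hx => ?_
    simp only [meanCurvatureVector, hmin x hx, zero_smul, smul_zero, sub_zero, sub_self,
      Real.rpow_zero, div_one, norm_smul, Real.norm_of_nonneg hp0.le]
    rw [Real.mul_rpow hp0.le (norm_nonneg _)]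
  rw [hD] at h
  -- The term with the normal component is nonnegative and is dropped.
  have h1 : (n - p) * A ≤ A ^ ((p - 1) / p) * (p * B ^ (1 / p)) := by
    rw [Real.mul_rpow (by positivity) hB0, ← Real.rpow_mul hp0.le, mul_one_div_cancel hp0.ne',
      Real.rpow_one] at h
    nlinarith
  -- Dividing by `A ^ ((p - 1) / p)` requires `A > 0`.
  rcases hA0.eq_or_lt with hA | hA
  · rw [← hA, mul_zero]; exact hB0
  have hAp : A = A ^ ((p - 1) / p) * A ^ (1 / p) := by
    rw [← Real.rpow_add hA, show (p - 1) / p + 1 / p = 1 by field_simp; ring, Real.rpow_one]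
  have h2 : (n - p) * A ^ (1 / p) ≤ p * B ^ (1 / p) := by
    have hpos : 0 < A ^ ((p - 1) / p) := by positivity
    refine le_of_mul_le_mul_left ?_ hpos
    calc _ = (n - p) * (A ^ ((p - 1) / p) * A ^ (1 / p)) := by ring
      _ ≤ _ := by rw [← hAp]; exact h1
  have hnp : 0 ≤ (n : ℝ) - p := by linarith
  have h3 := Real.rpow_le_rpow (by positivity) h2 hp0.le
  rw [Real.mul_rpow hnp (by positivity), Real.mul_rpow hp0.le (by positivity),
    ← Real.rpow_mul hA0, ← Real.rpow_mul hB0, one_div_mul_cancel hp0.ne', Real.rpow_one,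
    Real.rpow_one] at h3
  rw [div_mul_eq_mul_div, div_le_iff₀ (by positivity)]
  linarith

end Hypersurface

end

/-! ### Optimality of the constant on the flat hypersurface -/

noncomputable section

namespace Hypersurface

variable {n : ℕ}

section Flat

theorem isSmoothHypersurface_flat (n : ℕ) : IsSmoothHypersurface (flat n) := by
  refine fun x _ => ⟨Set.univ, isOpen_univ, Set.mem_univ x, fun y => y (Fin.last n), ?_, ?_, ?_⟩
  · exact (EuclideanSpace.proj (Fin.last n) : Space n →L[ℝ] ℝ).contDiff.contDiffOn
  · intro y _
    rw [gradient_coord]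
    exact fun h => one_ne_zero (α := ℝ) (by simpa using congrArg (fun v => v (Fin.last n)) h)
  · ext y; simp [flat]

theorem isClosed_flat (n : ℕ) : IsClosed (flat n) :=
  isClosed_eq (EuclideanSpace.proj (Fin.last n) : Space n →L[ℝ] ℝ).continuous continuous_const

/-- `flat n` is the graph of `0` in a frame whose unit vector is the last basis vector, and the
Jacobian is `1`. -/
theorem exists_isometry_flat (n : ℕ) : ∃ ι : Base n →ₗᵢ[ℝ] Space n,
    (∀ y, ι y ∈ flat n) ∧ ∀ f : Space n → ℝ, ∫ x, f x ∂(vol (flat n)) = ∫ y, f (ι y) := by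
  have h1 : ‖(EuclideanSpace.single (Fin.last n) 1 : Space n)‖ = 1 := by simp
  obtain ⟨F, hF⟩ := Frame.exists_frame (norm_ne_zero_iff.1 (h1.trans_ne one_ne_zero))
  rw [h1, inv_one, one_smul] at hF
  have hr : flat n = Set.range (F.graphMap 0) := by
    ext z
    rw [F.mem_range_graphMap, hF, EuclideanSpace.inner_single_left]
    simp [flat, eq_comm]
  refine ⟨F.ι, fun y => hr ▸ ⟨y, by simp [Frame.graphMap]⟩, fun f => ?_⟩
  rw [vol, hr, setIntegral_graph F (u := 0) contDiff_const]
  refine integral_congr_ae (Eventually.of_forall fun y => ?_)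
  have hj : jac (0 : Base n → ℝ) y = 1 := by
    have : ∀ k, pderiv k (0 : Base n → ℝ) y = 0 := fun k => pderiv_zero k
    simp [jac, this]
  simp [hj, Frame.graphMap]

/-- For optimality an upper bound on the tangential gradient is enough, since the gradient stands on
the larger side of the assumed inequality. -/
theorem norm_ambientTangentialGradient_le {M : Set (Space n)} (hM : IsSmoothHypersurface M)
    {x : Space n} (hx : x ∈ M) (ψ : Space n → ℝ) :
    ‖ambientTangentialGradient M ψ x‖ ≤ ‖∇ ψ x‖ := by
  obtain ⟨F, u, h⟩ := hM.exists_isGraphNear hx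
  rw [h.ambientTangentialGradient_eq hM]
  exact norm_tproj_le (F.norm_normal _) _

end Flat

section Radial

/-- Polar coordinates followed by `r = e^t`, which turns `r^(n-1) dr` into `e^(nt) dt`. -/
theorem integrable_radial_iff (hn : 0 < n) (f : ℝ → ℝ) :
    Integrable (fun y : Base n => f ‖y‖) ↔
      Integrable (fun t => Real.exp t ^ n * f (Real.exp t)) := by
  have : Nonempty (Fin n) := ⟨⟨0, hn⟩⟩
  rw [integrable_fun_norm_addHaar (μ := (volume : Measure (Base n))) (f := f),
    ← Real.range_exp, ← Set.image_univ,
    integrableOn_image_iff_integrableOn_abs_deriv_smul MeasurableSet.univ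
      (fun x _ => (Real.hasDerivAt_exp x).hasDerivWithinAt) Real.exp_injective.injOn,
    integrableOn_univ]
  refine integrable_congr (Eventually.of_forall fun t => ?_)
  simp only [finrank_euclideanSpace, Fintype.card_fin, smul_eq_mul, abs_of_pos (Real.exp_pos _),
    ← mul_assoc]
  rw [mul_pow_sub_one hn.ne']

theorem integral_radial (hn : 0 < n) : ∃ c : ℝ, 0 < c ∧ ∀ f : ℝ → ℝ,
    ∫ y : Base n, f ‖y‖ = c * ∫ t, Real.exp t ^ n * f (Real.exp t) := by
  have : Nonempty (Fin n) := ⟨⟨0, hn⟩⟩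
  refine ⟨n * (volume : Measure (Base n)).real (Metric.ball 0 1), ?_, fun f => ?_⟩
  · have : 0 < (volume : Measure (Base n)).real (Metric.ball 0 1) :=
      ENNReal.toReal_pos (Metric.measure_ball_pos _ _ one_pos).ne' measure_ball_lt_top.ne
    positivity
  rw [integral_fun_norm_addHaar (volume : Measure (Base n)) f, ← Real.range_exp, ← Set.image_univ,
    integral_image_eq_integral_abs_deriv_smul MeasurableSet.univ
      (fun x _ => (Real.hasDerivAt_exp x).hasDerivWithinAt) Real.exp_injective.injOn,
    setIntegral_univ, finrank_euclideanSpace, Fintype.card_fin, nsmul_eq_mul, smul_eq_mul,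
    mul_assoc]
  refine congrArg _ (congrArg _ (integral_congr_ae (Eventually.of_forall fun t => ?_)))
  simp only [smul_eq_mul, abs_of_pos (Real.exp_pos _), ← mul_assoc]
  rw [mul_pow_sub_one hn.ne']

/-- The function `|x| ^ (-γ) h(log |x|)`. -/
def logRadial (γ : ℝ) (h : ℝ → ℝ) (x : Space n) : ℝ := ‖x‖ ^ (-γ) * h (Real.log ‖x‖)

variable {γ L : ℝ} {h : ℝ → ℝ}

theorem logRadial_eventuallyEq_zero (hγ : γ ≠ 0) (hL : ∀ t, L < |t| → h t = 0) :
    logRadial γ h =ᶠ[𝓝 (0 : Space n)] fun _ => 0 := by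
  filter_upwards [Metric.ball_mem_nhds (0 : Space n) (Real.exp_pos (-L))] with y hy
  rw [mem_ball_zero_iff] at hy
  rcases eq_or_ne y 0 with rfl | h0
  -- At the origin `0 ^ (-γ) = 0` because `γ ≠ 0`, so the value there is also zero.
  · simp [logRadial, Real.zero_rpow (neg_ne_zero.2 hγ)]
  · have : Real.log ‖y‖ < -L := by
      simpa using Real.log_lt_log (norm_pos_iff.2 h0) hy
    rw [logRadial, hL _ (by linarith [neg_abs_le (Real.log ‖y‖)]), mul_zero]

theorem contDiff_logRadial (hγ : γ ≠ 0) (hh : ContDiff ℝ 1 h) (hL : ∀ t, L < |t| → h t = 0) :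
    ContDiff ℝ 1 (logRadial γ h : Space n → ℝ) := by
  refine contDiff_iff_contDiffAt.2 fun x => ?_
  rcases eq_or_ne x 0 with rfl | h0
  · exact contDiffAt_const.congr_of_eventuallyEq (logRadial_eventuallyEq_zero hγ hL)
  · have hn : ContDiffAt ℝ 1 (fun y : Space n => ‖y‖) x := contDiffAt_norm ℝ h0
    have h1 := norm_ne_zero_iff.2 h0
    exact (hn.rpow_const_of_ne h1).mul (hh.contDiffAt.comp x (hn.log h1))

theorem isC1c_logRadial (hγ : γ ≠ 0) (hh : ContDiff ℝ 1 h) (hL : ∀ t, L < |t| → h t = 0)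
    {M : Set (Space n)} (hM : IsClosed M) : IsC1c M (logRadial γ h) := by
  refine ⟨fun x _ => ⟨logRadial γ h, (contDiff_logRadial hγ hh hL).contDiffAt,
    Eventually.of_forall fun _ => rfl⟩, M ∩ Metric.closedBall 0 (Real.exp L),
    Set.inter_subset_left, (isCompact_closedBall _ _).inter_left hM, fun x hx hxK => ?_⟩
  have hx' : Real.exp L < ‖x‖ := by
    by_contra hc
    exact hxK ⟨hx, mem_closedBall_zero_iff.2 (not_lt.1 hc)⟩
  have : L < Real.log ‖x‖ := by
    simpa using Real.log_lt_log (Real.exp_pos L) hx'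
  rw [logRadial, hL _ (this.trans_le (le_abs_self _)), mul_zero]

theorem norm_gradient_logRadial (hh : ContDiff ℝ 1 h) {x : Space n} (hx : x ≠ 0) :
    ‖∇ (logRadial γ h) x‖
      = ‖x‖ ^ (-γ - 1) * |deriv h (Real.log ‖x‖) - γ * h (Real.log ‖x‖)| := by
  have h0 : 0 < ‖x‖ := norm_pos_iff.2 hx
  have hd : DifferentiableAt ℝ (fun y : Space n => ‖y‖) x :=
    (contDiffAt_norm ℝ hx).differentiableAt one_ne_zero
  have h1 := (Real.hasDerivAt_rpow_const (p := -γ) (Or.inl h0.ne')).mul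
    (((hh.differentiable one_ne_zero (Real.log ‖x‖)).hasDerivAt).comp ‖x‖
      (Real.hasDerivAt_log h0.ne'))
  have h2 := h1.comp_hasFDerivAt x hd.hasFDerivAt
  have h3 : ‖∇ (logRadial γ h) x‖ = ‖fderiv ℝ (logRadial γ h) x‖ := by
    rw [gradient, LinearIsometryEquiv.norm_map]
  rw [h3, show fderiv ℝ (logRadial γ h) x = _ from h2.fderiv, norm_smul, norm_fderiv_norm hd,
    mul_one, Real.norm_eq_abs, ← abs_of_pos (Real.rpow_pos_of_pos h0 (-γ - 1)), ← abs_mul]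
  congr 1
  rw [abs_of_pos (Real.rpow_pos_of_pos h0 (-γ - 1)), Real.rpow_sub_one h0.ne']
  simp only [Function.comp]
  field_simp
  ring

/-- A Hardy inequality on the flat hypersurface, tested with radial functions. -/
theorem one_dimensional_of_flat {p C : ℝ} (hp : 1 ≤ p) (hpn : p < n)
    (hC : ∀ φ : Space n → ℝ, IsC1c (flat n) φ →
      C * ∫ x, |φ x| ^ p / ‖x‖ ^ p ∂(vol (flat n))
        ≤ ∫ x, ‖tangentialGradient (flat n) φ x‖ ^ p ∂(vol (flat n)))
    (hh : ContDiff ℝ 1 h) (hL : ∀ t, L < |t| → h t = 0) :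
    C * ∫ t, |h t| ^ p ≤ ∫ t, |deriv h t - (n - p) / p * h t| ^ p := by
  have hp0 : 0 < p := by linarith
  have hn : 0 < n := by exact_mod_cast hp0.trans hpn
  have : Nonempty (Fin n) := ⟨⟨0, hn⟩⟩
  set γ := (n - p) / p with hγ
  have hγ0 : 0 < γ := div_pos (by linarith) hp0
  have hγp : γ * p = n - p := by rw [hγ]; field_simp
  have hM := isSmoothHypersurface_flat n
  have hc1 := isC1c_logRadial hγ0.ne' hh hL (isClosed_flat n)
  have key := hC _ hc1
  obtain ⟨ι, hιmem, hι⟩ := exists_isometry_flat n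
  obtain ⟨c, hc0, hc⟩ := integral_radial hn
  let G : ℝ → ℝ := fun r => (r ^ (-γ - 1) * |deriv h (Real.log r) - γ * h (Real.log r)|) ^ p
  -- The exponent `γ = (n - p) / p` is the one for which `n - (γ + 1) p = 0`, so that all weights
  -- disappear in the variable `t = log r`.
  have hexp : ∀ t : ℝ, Real.exp t ^ n * Real.exp (-(γ + 1) * t) ^ p = 1 := by
    intro t
    rw [← Real.exp_nat_mul, ← Real.exp_mul, ← Real.exp_add, Real.exp_eq_one_iff]
    linear_combination (-t) * hγp
  have hGexp : ∀ t, Real.exp t ^ n * G (Real.exp t) = |deriv h t - γ * h t| ^ p := by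
    intro t
    simp only [G, Real.log_exp]
    rw [Real.mul_rpow (by positivity) (abs_nonneg _), ← Real.exp_mul, ← mul_assoc,
      show t * (-γ - 1) = -(γ + 1) * t by ring, hexp, one_mul]
  have hGint : Integrable fun y : Base n => G ‖y‖ := by
    rw [integrable_radial_iff hn, funext hGexp]
    have hcont : Continuous (deriv h) := hh.continuous_deriv le_rfl
    refine Continuous.integrable_of_hasCompactSupport
      (((hcont.sub (continuous_const.mul hh.continuous)).abs).rpow_const fun _ => Or.inr hp0.le) ?_
    refine HasCompactSupport.intro (isCompact_Icc (a := -L) (b := L)) fun t ht => ?_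
    have ht' : L < |t| := by
      by_contra hcon
      exact ht (abs_le.1 (not_lt.1 hcon))
    have hev : h =ᶠ[𝓝 t] fun _ => 0 := by
      filter_upwards [continuous_abs.continuousAt.eventually (lt_mem_nhds ht')] with s hs
      exact hL s hs
    rw [hev.deriv_eq, hL t ht']
    simp [hp0.ne']
  rw [hι, hι] at key
  have e1 : ∫ y : Base n, |logRadial γ h (ι y)| ^ p / ‖ι y‖ ^ p = c * ∫ t, |h t| ^ p := by
    have := hc fun r => |r ^ (-γ) * h (Real.log r)| ^ p / r ^ p
    simp only [logRadial, ι.norm_map]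
    rw [this]
    congr 2
    funext t
    rw [Real.log_exp, abs_mul, Real.mul_rpow (abs_nonneg _) (abs_nonneg _), ← Real.exp_mul,
      Real.abs_exp, mul_div_right_comm, ← mul_assoc, ← Real.div_rpow (Real.exp_pos _).le
      (Real.exp_pos _).le, ← Real.exp_sub, show t * -γ - t = -(γ + 1) * t by ring, hexp, one_mul]
  have e2 : ∫ y : Base n, ‖tangentialGradient (flat n) (logRadial γ h) (ι y)‖ ^ p
      ≤ c * ∫ t, |deriv h t - γ * h t| ^ p := by
    rw [← funext hGexp, ← hc]
    refine integral_mono_of_nonneg (Eventually.of_forall fun y => by positivity) hGint ?_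
    filter_upwards [compl_mem_ae_iff.2 (measure_singleton (0 : Base n))] with y hy0
    have hy := hιmem y
    have hy1 : ι y ≠ 0 := fun h0 => hy0 (ι.injective (h0.trans ι.map_zero.symm))
    obtain ⟨F, u, hF⟩ := hM.exists_isGraphNear hy
    refine Real.rpow_le_rpow (norm_nonneg _) ?_ hp0.le
    rw [hF.tangentialGradient_eq hM ⟨(contDiff_logRadial hγ0.ne' hh hL).contDiffAt,
      Eventually.of_forall fun _ => rfl⟩]
    refine (norm_ambientTangentialGradient_le hM hy _).trans_eq ?_
    rw [norm_gradient_logRadial hh hy1, ι.norm_map]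
  rw [e1] at key
  refine le_of_mul_le_mul_left ?_ hc0
  linarith

end Radial

/-- Dilations of a bump function show that the constant of a one-dimensional inequality is at
most `γ ^ p`. -/
theorem le_rpow_of_one_dimensional {p C γ : ℝ} (hp : 1 ≤ p) (hγ : 0 < γ)
    (hC : ∀ (h : ℝ → ℝ) (L : ℝ), ContDiff ℝ 1 h → (∀ t, L < |t| → h t = 0) →
      C * ∫ t, |h t| ^ p ≤ ∫ t, |deriv h t - γ * h t| ^ p) : C ≤ γ ^ p := by
  have hp0 : 0 < p := by linarith
  let η : ContDiffBump (0 : ℝ) := ⟨1, 2, one_pos, one_lt_two⟩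
  have hη : ContDiff ℝ 1 η := η.contDiff
  have hη' : Continuous (deriv η) := hη.continuous_deriv le_rfl
  have hsupp : ∀ t, 2 < |t| → η t = 0 := fun t ht =>
    η.zero_of_le_dist (by simpa using ht.le)
  -- Test with `η (δ t)`: the change of variables yields the same factor `δ⁻¹` on both sides, and
  -- `δ` survives only in front of the derivative.
  have hscaled : ∀ δ : ℝ, 0 < δ →
      C * ∫ t, |η t| ^ p ≤ ∫ t, |δ * deriv η t - γ * η t| ^ p := by
    intro δ hδ
    have h1 := hC (fun t => η (δ * t)) (2 / δ) (hη.comp (contDiff_const.mul contDiff_id))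
      fun t ht => hsupp _ (by
        rw [abs_mul, abs_of_pos hδ]
        rwa [div_lt_iff₀' hδ] at ht)
    have hd : ∀ t, deriv (fun t => η (δ * t)) t = δ * deriv η (δ * t) := fun t => by
      simpa using deriv_comp_mul_left δ η t
    simp only [hd] at h1
    rw [Measure.integral_comp_mul_left (fun t => |η t| ^ p),
      Measure.integral_comp_mul_left (fun t => |δ * deriv η t - γ * η t| ^ p), smul_eq_mul,
      smul_eq_mul, mul_left_comm] at h1
    exact le_of_mul_le_mul_left h1 (by positivity)
  have hcs : HasCompactSupport η := η.hasCompactSupport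
  have hint : Integrable fun t => |η t| ^ p :=
    (η.continuous.abs.rpow_const fun _ => Or.inr hp0.le).integrable_of_hasCompactSupport
      (hcs.comp_left (g := fun s => |s| ^ p) (by simp [hp0.ne']))
  have hpos : 0 < ∫ t, |η t| ^ p := by
    refine (integral_pos_iff_support_of_nonneg (fun t => by positivity) hint).2 ?_
    refine (η.continuous.abs.rpow_const fun _ => Or.inr hp0.le).isOpen_support.measure_pos _
      ⟨0, ?_⟩
    have : η 0 = 1 := η.one_of_mem_closedBall (by simp [η])
    simp [this]
  -- As `δ → 0` the derivative term disappears and the right-hand side tends to `γ ^ p ∫ |η|^p`;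
  -- dividing by the positive integral of `|η|^p` gives the bound on `C`.
  have hlim : Tendsto (fun δ : ℝ => ∫ t, |δ * deriv η t - γ * η t| ^ p) (𝓝[>] 0)
      (𝓝 (∫ t, |0 * deriv η t - γ * η t| ^ p)) := by
    refine tendsto_integral_filter_of_dominated_convergence
      (fun t => (|deriv η t| + γ * |η t|) ^ p) ?_ ?_ ?_ ?_
    · exact Eventually.of_forall fun δ => ((((continuous_const.mul hη').sub
        (continuous_const.mul η.continuous)).abs).rpow_const
          fun _ => Or.inr hp0.le).aestronglyMeasurable
    · filter_upwards [Ioo_mem_nhdsGT one_pos] with δ hδ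
      refine Eventually.of_forall fun t => ?_
      rw [Real.norm_of_nonneg (by positivity)]
      refine Real.rpow_le_rpow (abs_nonneg _) ((abs_sub _ _).trans ?_) hp0.le
      rw [abs_mul, abs_mul, abs_of_pos hδ.1, abs_of_pos hγ]
      gcongr
      exact mul_le_of_le_one_left (abs_nonneg _) hδ.2.le
    · refine Continuous.integrable_of_hasCompactSupport ((hη'.abs.add
        (continuous_const.mul η.continuous.abs)).rpow_const fun _ => Or.inr hp0.le) ?_
      refine HasCompactSupport.intro (K := tsupport η) hcs fun t ht => ?_
      have hev := notMem_tsupport_iff_eventuallyEq.1 ht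
      rw [hev.deriv_eq, hev.self_of_nhds]
      simp [hp0.ne']
    · refine Eventually.of_forall fun t => ?_
      have : Continuous fun δ : ℝ => |δ * deriv η t - γ * η t| ^ p :=
        (by fun_prop : Continuous fun δ : ℝ => |δ * deriv η t - γ * η t|).rpow_const
          fun _ => Or.inr hp0.le
      exact (this.tendsto 0).mono_left nhdsWithin_le_nhds
  have hle := ge_of_tendsto hlim (eventually_nhdsWithin_of_forall hscaled)
  have e : ∫ t, |0 * deriv η t - γ * η t| ^ p = γ ^ p * ∫ t, |η t| ^ p := by
    rw [← integral_const_mul]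
    congr 1
    funext t
    rw [zero_mul, zero_sub, abs_neg, abs_mul, abs_of_pos hγ, Real.mul_rpow hγ.le (abs_nonneg _)]
  rw [e] at hle
  exact le_of_mul_le_mul_right hle hpos

/-- Optimality of the constant of the Hardy inequality on the flat hypersurface. -/
theorem hardy_const_optimal {p C : ℝ} (hp : 1 ≤ p) (hpn : p < n)
    (hC : ∀ φ : Space n → ℝ, IsC1c (flat n) φ →
      C * ∫ x, |φ x| ^ p / ‖x‖ ^ p ∂(vol (flat n))
        ≤ ∫ x, ‖tangentialGradient (flat n) φ x‖ ^ p ∂(vol (flat n))) :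
    C ≤ (n - p) ^ p / p ^ p := by
  rw [← Real.div_rpow (by linarith) (by linarith)]
  exact le_rpow_of_one_dimensional hp (div_pos (by linarith) (by linarith))
    fun h L hh hL => one_dimensional_of_flat hp hpn hC hh hL

end Hypersurface

end

theorem theorem3p1 (n : ℕ) (p : ℝ) (hp : 1 ≤ p) :
    -- the inequality on an arbitrary hypersurface, all integrals being finite
    (∀ M : Set (Hypersurface.Space n), Hypersurface.IsSmoothHypersurface M →
      ∀ a : ℝ, 0 ≤ a → a < n → ∀ φ : Hypersurface.Space n → ℝ, Hypersurface.IsC1c M φ →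
        Integrable (fun x => |φ x| ^ p / ‖x‖ ^ a) (Hypersurface.vol M) ∧
        Integrable (fun x => (inner ℝ (‖x‖⁻¹ • x) (Hypersurface.unitNormal M x)) ^ 2
          * (|φ x| ^ p / ‖x‖ ^ a)) (Hypersurface.vol M) ∧
        Integrable (fun x => ‖p • Hypersurface.tangentialGradient M φ x
          - φ x • Hypersurface.meanCurvatureVector M x‖ ^ p / ‖x‖ ^ (a - p))
          (Hypersurface.vol M) ∧
        (n - a) * ∫ x, |φ x| ^ p / ‖x‖ ^ a ∂(Hypersurface.vol M)
          + a * ∫ x, (inner ℝ (‖x‖⁻¹ • x) (Hypersurface.unitNormal M x)) ^ 2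
              * (|φ x| ^ p / ‖x‖ ^ a) ∂(Hypersurface.vol M)
          ≤ (∫ x, |φ x| ^ p / ‖x‖ ^ a ∂(Hypersurface.vol M)) ^ ((p - 1) / p)
            * (∫ x, ‖p • Hypersurface.tangentialGradient M φ x
                - φ x • Hypersurface.meanCurvatureVector M x‖ ^ p / ‖x‖ ^ (a - p)
                ∂(Hypersurface.vol M)) ^ (1 / p)) ∧
    -- the Euclidean Hardy inequality on minimal hypersurfaces, with a constant that is
    -- optimal for the flat hypersurface
    (p < n →
      (∀ M : Set (Hypersurface.Space n), Hypersurface.IsSmoothHypersurface M →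
        Hypersurface.IsMinimal M →
        ∀ φ : Hypersurface.Space n → ℝ, Hypersurface.IsC1c M φ →
          (n - p) ^ p / p ^ p * ∫ x, |φ x| ^ p / ‖x‖ ^ p ∂(Hypersurface.vol M)
            ≤ ∫ x, ‖Hypersurface.tangentialGradient M φ x‖ ^ p ∂(Hypersurface.vol M)) ∧
      (∀ C : ℝ,
        (∀ φ : Hypersurface.Space n → ℝ, Hypersurface.IsC1c (Hypersurface.flat n) φ →
          C * ∫ x, |φ x| ^ p / ‖x‖ ^ p ∂(Hypersurface.vol (Hypersurface.flat n))
            ≤ ∫ x, ‖Hypersurface.tangentialGradient (Hypersurface.flat n) φ x‖ ^ p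
                ∂(Hypersurface.vol (Hypersurface.flat n))) →
        C ≤ (n - p) ^ p / p ^ p)) := by
  refine ⟨fun M hM a ha han φ hφ => Hypersurface.hardy_weighted hM hφ hp ha han, fun hpn =>
    ⟨fun M hM hmin φ hφ => Hypersurface.hardy_minimal hM hmin hφ hp hpn, fun C hC =>
      Hypersurface.hardy_const_optimal hp hpn hC⟩⟩
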